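/- **Setting.** Let $Y\subseteq\mathbb R^{d'}$ be nonempty, closed and convex, let $f:\mathbb R^d\times\mathbb R^{d'}\to\mathbb R$ have partial gradients at all points of $Z=\mathbb R^d\times Y$, and put $P(x)=\max_{y\in Y}f(x,y)$ and $\mathrm{Gap}(x,y)=\max_{y'\in Y}f(x,y')-\min_{x'\in\mathbb R^d}f(x',y)$. Let $L\ge 0$, $0<\rho\le\ell$, $\mu,\mu_x,\mu_y,B>0$ with $\mu\le L+2\rho$. Assume: * $(\nabla_xf,-\nabla_yf)$ is $\ell$-Lipschitz on $Z$; $f(x,\cdot)$ is $\mu_y$-strongly concave on $Y$ for every $x$; $f(\cdot,y)$ is $\rho$-weakly convex for every $y\in Y$; * $P$ is differentiable with $L$-Lipschitz gradient, attains its minimum, and satisfies the $\mu$-PL condition $\|\nabla P(x)\|^2\ge 2\mu(P(x)-\min P)$ for all $x$; * for every $y\in Y$, $f(\cdot,y)$ attains its minimum and $\|\nabla_xf(x,y)\|^2\ge2\mu_x(f(x,y)-\min_{x'}f(x',y))$ for all $x$. **Oracle.** For $(x,y)\in Z$ and $\xi\sim D$, a jointly measurable oracle returns unbiased stochastic gradients: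 $\mathbb E[\mathcal G_x(x,y;\xi)]=\nabla_xf(x,y)$ and $\mathbb E[\mathcal G_y(x,y;\xi)]=\nabla_yf(x,y)$. **Algorithm (PES-SGDA).** Put $\gamma=2\rho$, $\hat L=L+2\rho$, $c=4\rho+\frac{248}{53}\hat L$, $\alpha=\frac{2\mu}{c+2\mu}$. Given $(x_0,y_0)\in Z$ and $0<\eta_0\le1/\rho$, for $k=1,2,\dots$ let $$\eta_k=\eta_0e^{-(k-1)\alpha},\qquad T_k=\Big\lceil\frac{424}{\eta_0\min\{\rho,\mu_y\}}e^{(k-1)\alpha}\Big\rceil .$$ Epoch $k$ starts at $z_0^k=(x_0^k,y_0^k)=(x_{k-1},y_{k-1})$, computes for $t=1,\dots,T_k$ $$z_t^k=\arg\min_{z=(x,y)\in Z}\Big\{\eta_k\big(\langle\mathcal G_x(z_{t-1}^k;\xi^k_{t-1}),x\rangle-\langle\mathcal G_y(z_{t-1}^k;\xi^k_{t-1}),y\rangle\big)+\tfrac12\|z-z_{t-1}^k\|^2+\tfrac{\gamma\eta_k}2\|x-x_0^k\|^2\Big\},$$ and returns $(x_k,y_k)=\frac1{T_k}\sum_{t=1}^{T_k}z_t^k$.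 All samples $\xi_t^k$ are independent with law $D$. The stochastic gradients used are bounded by $B$ in mean square along the run: $\mathbb E\|\mathcal G_x(z_{t}^k;\xi_{t}^k)\|^2\le B^2$ and $\mathbb E\|\mathcal G_y(z_{t}^k;\xi_{t}^k)\|^2\le B^2$ for all $k\ge1$ and $0\le t<T_k$ (in particular this holds if all stochastic gradients are bounded by $B$). **Claim.** To reach an expected duality gap of at most $\epsilon$ it takes $\widetilde O\left(\frac{(L+\rho)^2(\rho/\mu_x+1)B^2}{\mu^2\min\{\rho,\mu_y\}\epsilon}\right)$ iterations in total, as $\epsilon\to0$. Precisely: there is an absolute constant $C$ such that for all parameters $\ell,L,\rho,\mu,\mu_x,\mu_y,B,\eta_0$ as above there is $\bar\epsilon>0$, depending only on these parameters, such that for every $0<\epsilon<\bar\epsilon$ there is a number of epochs $K$, depending only on these parameters and $\epsilon$, with $$\sum_{k=1}^KT_k\le C\,\frac{(L+\rho)^2(\rho/\mu_x+1)B^2}{\mu^2\min\{\rho,\mu_y\}\,\epsilon}\,\log\frac1\epsilon,$$ and for every problem as above, in any dimensions $d,d'$ and for any starting point, $\mathrm{Gap}(x_K,y_K)$ is integrable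 with $\mathbb E[\mathrm{Gap}(x_K,y_K)]\le\epsilon$. -/

import Mathlib

open MeasureTheory ProbabilityTheory

noncomputable section

namespace MinMaxPL

section Objective

variable {E F : Type*} [NormedAddCommGroup E] [InnerProductSpace ℝ E] [CompleteSpace E]
  [NormedAddCommGroup F] [InnerProductSpace ℝ F] [CompleteSpace F]

/-- The primal function `P(x) = max_{y ∈ Y} f(x, y)`. -/
def primal (f : E → F → ℝ) (Y : Set F) (x : E) : ℝ := ⨆ y : Y, f x y

/-- The duality gap `max_{y' ∈ Y} f(x, y') - min_{x'} f(x', y)`. -/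
def dualityGap (f : E → F → ℝ) (Y : Set F) (x : E) (y : F) : ℝ :=
  (⨆ y' : Y, f x y') - ⨅ x' : E, f x' y

/-- `h` is differentiable on the whole space with an `L`-Lipschitz gradient. -/
def IsSmoothFun (L : ℝ) (h : E → ℝ) : Prop :=
  Differentiable ℝ h ∧ ∀ x x' : E, ‖gradient h x - gradient h x'‖ ≤ L * ‖x - x'‖

/-- `h` attains its global minimum and satisfies the `m`-Polyak-Lojasiewicz inequality. -/
def SatisfiesPL (m : ℝ) (h : E → ℝ) : Prop :=
  ∃ xs : E, (∀ x, h xs ≤ h x) ∧ ∀ x, 2 * m * (h x - h xs) ≤ ‖gradient h x‖ ^ 2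

/-- `h` is `ρ`-weakly convex on the whole space (first-order form). -/
def IsWeaklyConvex (ρ : ℝ) (h : E → ℝ) : Prop :=
  ∀ x x' : E, inner ℝ (gradient h x') (x - x') - ρ / 2 * ‖x - x'‖ ^ 2 ≤ h x - h x'

/-- The partial gradient `∇ₓ f(x, y)`. -/
def gradX (f : E → F → ℝ) (x : E) (y : F) : E := gradient (fun x' => f x' y) x

/-- The partial gradient `∇_y f(x, y)`. -/
def gradY (f : E → F → ℝ) (x : E) (y : F) : F := gradient (fun y' => f x y') y

/-- Both partial gradients of `f` exist at every point of `Z = E × Y`, and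
`F(z) = (∇ₓ f, -∇_y f)` is `ℓ`-Lipschitz on `Z` for the Euclidean norm of the product. -/
def HasLipschitzGradOn (ℓ : ℝ) (f : E → F → ℝ) (Y : Set F) : Prop :=
  (∀ x, ∀ y ∈ Y, DifferentiableAt ℝ (fun x' => f x' y) x ∧
      DifferentiableAt ℝ (fun y' => f x y') y) ∧
  ∀ x x', ∀ y ∈ Y, ∀ y' ∈ Y,
    ‖gradX f x y - gradX f x' y'‖ ^ 2 + ‖gradY f x y - gradY f x' y'‖ ^ 2
      ≤ ℓ ^ 2 * (‖x - x'‖ ^ 2 + ‖y - y'‖ ^ 2)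

end Objective

section Algorithm

variable {E F Ξ : Type*} [NormedAddCommGroup E] [InnerProductSpace ℝ E]
  [NormedAddCommGroup F] [InnerProductSpace ℝ F]

/-- The function of `z = (x, y)` that an SGDA step minimizes over `E × Y`:
`η 𝒢ᵀ z + ½ ‖z - z̄‖² + (γ η / 2) ‖x - x₀‖²`, where `𝒢 = (g.1, -g.2)` and `g` is the pair of
stochastic gradients in `x` and in `y`. -/
def stepObjective (γ η : ℝ) (x₀ : E) (zbar g z : E × F) : ℝ :=
  η * (inner ℝ g.1 z.1 - inner ℝ g.2 z.2)
    + (‖z.1 - zbar.1‖ ^ 2 + ‖z.2 - zbar.2‖ ^ 2) / 2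
    + γ * η / 2 * ‖z.1 - x₀‖ ^ 2

/-- The SGDA step: the minimizer of `stepObjective` over `E × Y`
(it exists and is unique when `Y` is nonempty, closed and convex and `0 ≤ γ * η`). -/
def sgdaStep (Y : Set F) (γ η : ℝ) (x₀ : E) (zbar g : E × F) : E × F :=
  Classical.epsilon fun z : E × F =>
    z.2 ∈ Y ∧ ∀ w : E × F, w.2 ∈ Y → stepObjective γ η x₀ zbar g z ≤ stepObjective γ η x₀ zbar g w

/-- The iterates `z_0, z_1, …` of one epoch of SGDA started at (and regularized around) `z₀`;
`G z ξ` is the pair of stochastic gradients at `z`, and step `t + 1` uses the sample `ξ t`. -/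
def sgdaIter (Y : Set F) (γ η : ℝ) (G : E × F → Ξ → E × F) (z₀ : E × F) (ξ : ℕ → Ξ) :
    ℕ → E × F
  | 0 => z₀
  | t + 1 => sgdaStep Y γ η z₀.1 (sgdaIter Y γ η G z₀ ξ t) (G (sgdaIter Y γ η G z₀ ξ t) (ξ t))

/-- The output of one epoch: the average of `z_1, …, z_T`. -/
def sgdaEpoch (Y : Set F) (γ η : ℝ) (T : ℕ) (G : E × F → Ξ → E × F) (z₀ : E × F) (ξ : ℕ → Ξ) :
    E × F :=
  (1 / (T : ℝ)) • ∑ t ∈ Finset.range T, sgdaIter Y γ η G z₀ ξ (t + 1)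

/-- The output `(x_k, y_k)` of the proximal epoch method after `k` epochs. Epochs are numbered
from `0`: epoch `k` starts at `(x_k, y_k)` and uses step size `η k`, length `T k` and the samples
`ξ k 0, ξ k 1, …`. -/
def pesSGDA (Y : Set F) (γ : ℝ) (η : ℕ → ℝ) (T : ℕ → ℕ) (G : E × F → Ξ → E × F) (z₀ : E × F)
    (ξ : ℕ → ℕ → Ξ) : ℕ → E × F
  | 0 => z₀
  | k + 1 => sgdaEpoch Y γ (η k) (T k) G (pesSGDA Y γ η T G z₀ ξ k) (ξ k)

/-- The `t`-th inner iterate of epoch `k` of the proximal epoch method. -/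
def pesInner (Y : Set F) (γ : ℝ) (η : ℕ → ℝ) (T : ℕ → ℕ) (G : E × F → Ξ → E × F) (z₀ : E × F)
    (ξ : ℕ → ℕ → Ξ) (k t : ℕ) : E × F :=
  sgdaIter Y γ (η k) G (pesSGDA Y γ η T G z₀ ξ k) (ξ k) t

end Algorithm

section Schedule

/-- `c = 4 ρ + (248 / 53) L̂` with `L̂ = L + 2 ρ`. -/
def cConst (L ρ : ℝ) : ℝ := 4 * ρ + 248 / 53 * (L + 2 * ρ)

/-- The geometric rate `2 μ / (c + 2 μ)`. -/
def rate (L ρ μ : ℝ) : ℝ := 2 * μ / (cConst L ρ + 2 * μ)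

/-- The step size of epoch `k` (epochs numbered from `0`). -/
def stepSize (L ρ μ η₀ : ℝ) (k : ℕ) : ℝ := η₀ * Real.exp (-(k * rate L ρ μ))

/-- The number of inner iterations of epoch `k` (epochs numbered from `0`), rounded up:
`(212 C₁ / (η₀ min{ρ, μ_y})) exp(k · rate)` with `C₁ = 2`. -/
def epochLength (L ρ μ μy η₀ : ℝ) (k : ℕ) : ℕ :=
  ⌈212 * 2 / (η₀ * min ρ μy) * Real.exp (k * rate L ρ μ)⌉₊

end Schedule

section Run

variable {E F Ξ : Type*} [NormedAddCommGroup E] [InnerProductSpace ℝ E]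
  [NormedAddCommGroup F] [InnerProductSpace ℝ F]

/-- The output after `K` epochs of the proximal epoch method with SGDA updates, with `γ = 2 ρ`,
step sizes `stepSize` and epoch lengths `epochLength`, started at `z₀`. -/
def output (L ρ μ μy η₀ : ℝ) (Y : Set F) (Gx : E → F → Ξ → E) (Gy : E → F → Ξ → F)
    (z₀ : E × F) (ξ : ℕ → ℕ → Ξ) (K : ℕ) : E × F :=
  pesSGDA Y (2 * ρ) (stepSize L ρ μ η₀) (epochLength L ρ μ μy η₀)
    (fun z s => (Gx z.1 z.2 s, Gy z.1 z.2 s)) z₀ ξ K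

/-- The point at which the stochastic gradient is queried with sample `ξ k t` in that run. -/
def queryPoint (L ρ μ μy η₀ : ℝ) (Y : Set F) (Gx : E → F → Ξ → E) (Gy : E → F → Ξ → F)
    (z₀ : E × F) (ξ : ℕ → ℕ → Ξ) (k t : ℕ) : E × F :=
  pesInner Y (2 * ρ) (stepSize L ρ μ η₀) (epochLength L ρ μ μy η₀)
    (fun z s => (Gx z.1 z.2 s, Gy z.1 z.2 s)) z₀ ξ k t

/-- The stochastic gradients that the run uses have second moments at most `B ^ 2`. -/
def BoundedGradAlongRun {Ω : Type*} [MeasurableSpace Ω] (P : Measure Ω)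
    (L ρ μ μy η₀ B : ℝ) (Y : Set F) (Gx : E → F → Ξ → E) (Gy : E → F → Ξ → F)
    (z₀ : E × F) (ξ : ℕ → ℕ → Ω → Ξ) : Prop :=
  ∀ k t, t < epochLength L ρ μ μy η₀ k →
    let z : Ω → E × F := fun ω => queryPoint L ρ μ μy η₀ Y Gx Gy z₀ (fun i j => ξ i j ω) k t
    ∫⁻ ω, ‖Gx (z ω).1 (z ω).2 (ξ k t ω)‖ₑ ^ 2 ∂P ≤ ENNReal.ofReal (B ^ 2) ∧
      ∫⁻ ω, ‖Gy (z ω).1 (z ω).2 (ξ k t ω)‖ₑ ^ 2 ∂P ≤ ENNReal.ofReal (B ^ 2)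

end Run

end MinMaxPL

end

/-! Adding `ρ‖x - a‖²` makes a `ρ`-weakly convex function `ρ`-strongly convex. An epoch anchored at
its start `a` therefore runs SGDA on a strongly convex–strongly concave problem, whose duality gap
is `regGap f Y ρ a`.

Inside an epoch, the gap of the averaged iterate is at most the squared distances from the start to
the best responses, divided by `ηT`, plus noise (`sum_step_le`). Strong convexity and concavity
bound these distances by the regularized gaps before and after the epoch (`dist_best_response_le`).
As `ηT min{ρ, μ_y} ≥ 424`, the gap shrinks by the factor 105 up to noise (`epoch_le`). The best
responses depend on the samples, so these bounds are pathwise. Noise tested against them is split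
into a martingale measured from the start of the epoch, with mean zero, and the square of a sum of
martingale differences. The expected noise is `O(ηB²)` to first order in `η`
(`integral_epochNoise_le`).

From epoch to epoch, a small regularized gap forces `∇P(x) + 2ρ(x - a)` to be small and `ρ‖x - a‖²`
to be paid for by the decrease of `P`. The PL condition on `P` then makes `potential`, a weighted
sum of `P - min P` and the regularized gap, contract by `1 - α` with `α = rate L ρ μ` (`pl_step`,
`recenter_le`, `potential_le`). The initial potential is controlled by the gradients at the start,
hence by `B` (`potential_le_grad`); this makes `K` independent of the problem and the starting
point. The PL condition in `x` turns the final regularized gap into the duality gap, at the price of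
`4(ρ/μ_x + 1)` (`dualityGap_le`).

Step sizes decay like `exp(-kα)`, at least as slowly as the contraction, so each epoch adds at most
order `B²η₀ exp(-Kα)` to the final error, while `K` epochs cost about `exp(Kα)/(η₀ α min{ρ, μ_y})`
iterations. Balancing the two makes `η₀` cancel and gives the stated complexity
(`exists_epochs_of_params`). -/

namespace MinMaxPL

/-! ### First-order inequalities for strongly concave and for smooth functions. -/

section FirstOrder

variable {E : Type*} [NormedAddCommGroup E] [InnerProductSpace ℝ E] [CompleteSpace E]

lemma hasDerivAt_comp_segment {g : E → ℝ} {y : E} (v : E) (t : ℝ)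
    (hg : DifferentiableAt ℝ g (y + t • v)) :
    HasDerivAt (fun s : ℝ => g (y + s • v)) (inner ℝ (gradient g (y + t • v)) v) t := by
  have h1 : HasDerivAt (fun s : ℝ => y + s • v) v t := by
    simpa using ((hasDerivAt_id t).smul_const v).const_add y
  have h2 := hg.hasFDerivAt.comp_hasDerivAt t h1
  rw [inner_gradient_left]
  exact h2

/-- First-order form of strong concavity at a point of differentiability. -/
lemma StrongConcaveOn.le_of_differentiableAt {Y : Set E} {m : ℝ} {g : E → ℝ}
    (hg : StrongConcaveOn Y m g) {y y' : E} (hy : y ∈ Y) (hy' : y' ∈ Y)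
    (hd : DifferentiableAt ℝ g y) :
    g y' ≤ g y + inner ℝ (gradient g y) (y' - y) - m / 2 * ‖y' - y‖ ^ 2 := by
  have hder := hasDerivAt_comp_segment (y' - y) 0 (by simpa using hd)
  have hlim := hder.tendsto_slope_zero_right
  simp only [zero_add, zero_smul, add_zero, smul_eq_mul] at hlim
  -- Strong concavity bounds the difference quotient at `t` from below by this affine function of
  -- `t`. Only `t > 0` is available, since the segment stays in `Y` only towards `y'`.
  have hlow : Filter.Tendsto (fun t : ℝ => g y' - g y + (1 - t) * (m / 2 * ‖y' - y‖ ^ 2))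
      (nhdsWithin 0 (Set.Ioi 0)) (nhds (g y' - g y + (1 - 0) * (m / 2 * ‖y' - y‖ ^ 2))) := by
    refine Filter.Tendsto.mono_left (Continuous.tendsto ?_ 0) nhdsWithin_le_nhds
    fun_prop
  have key := le_of_tendsto_of_tendsto hlow hlim (by
    filter_upwards [Ioo_mem_nhdsGT (zero_lt_one' ℝ)] with t ht
    have h := hg.2 hy hy' (by linarith [ht.2] : 0 ≤ 1 - t) ht.1.le (by ring)
    have e : (1 - t) • y + t • y' = y + t • (y' - y) := by module
    rw [e] at h
    simp only [smul_eq_mul, norm_sub_rev y y'] at h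
    rw [inv_mul_eq_div, le_div_iff₀ ht.1]
    nlinarith)
  linarith

omit [CompleteSpace E] in
/-- A maximizer of a strongly concave function over its domain beats the other points
quadratically. -/
lemma StrongConcaveOn.add_sq_le_of_isMax {Y : Set E} {m : ℝ} {g : E → ℝ}
    (hg : StrongConcaveOn Y m g) {y y' : E} (hy : y ∈ Y) (hy' : y' ∈ Y)
    (hmax : ∀ w ∈ Y, g w ≤ g y) : g y' + m / 2 * ‖y' - y‖ ^ 2 ≤ g y := by
  have hlow : Filter.Tendsto (fun t : ℝ => g y' + (1 - t) * (m / 2 * ‖y' - y‖ ^ 2))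
      (nhdsWithin 0 (Set.Ioi 0)) (nhds (g y' + (1 - 0) * (m / 2 * ‖y' - y‖ ^ 2))) := by
    refine Filter.Tendsto.mono_left (Continuous.tendsto ?_ 0) nhdsWithin_le_nhds
    fun_prop
  have key := le_of_tendsto hlow (b := g y) (by
    filter_upwards [Ioo_mem_nhdsGT (zero_lt_one' ℝ)] with t ht
    have h := hg.2 hy hy' (by linarith [ht.2] : 0 ≤ 1 - t) ht.1.le (by ring)
    have h2 := hmax _ (hg.1 hy hy' (by linarith [ht.2] : 0 ≤ 1 - t) ht.1.le (by ring))
    simp only [smul_eq_mul, norm_sub_rev y y'] at h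
    have h3 : t * (g y' + (1 - t) * (m / 2 * ‖y' - y‖ ^ 2)) ≤ t * g y := by nlinarith
    exact le_of_mul_le_mul_left h3 ht.1)
  linarith

/-- Descent estimate for a function with Lipschitz gradient. -/
lemma IsSmoothFun.descent {L : ℝ} {h : E → ℝ} (hL : 0 ≤ L) (hh : IsSmoothFun L h) (x v : E) :
    h (x + v) ≤ h x + inner ℝ (gradient h x) v + L * ‖v‖ ^ 2 := by
  have hd : ∀ t : ℝ, HasDerivAt (fun s : ℝ => h (x + s • v))
      (inner ℝ (gradient h (x + t • v)) v) t := fun t => hasDerivAt_comp_segment v t (hh.1 _)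
  -- The mean value theorem gives the coefficient `L` instead of the sharp `L / 2`; the step length
  -- in `grad_reg_sq_le` allows for it.
  obtain ⟨c, hc, hc'⟩ := exists_hasDerivAt_eq_slope (fun s : ℝ => h (x + s • v))
    (fun t => inner ℝ (gradient h (x + t • v)) v) zero_lt_one
    (fun t _ => (hd t).continuousAt.continuousWithinAt) (fun t _ => hd t)
  simp only [one_smul, zero_smul, add_zero, sub_zero, div_one] at hc'
  have h1 : inner ℝ (gradient h (x + c • v) - gradient h x) v ≤ L * ‖v‖ ^ 2 := by
    refine (real_inner_le_norm _ _).trans ?_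
    have h2 := hh.2 (x + c • v) x
    rw [add_sub_cancel_left, norm_smul, Real.norm_of_nonneg hc.1.le] at h2
    have h3 : L * (c * ‖v‖) ≤ L * ‖v‖ :=
      mul_le_mul_of_nonneg_left (mul_le_of_le_one_left (norm_nonneg _) hc.2.le) hL
    nlinarith [norm_nonneg v]
  rw [inner_sub_left] at h1
  linarith

end FirstOrder

/-! ### The regularized saddle-point problem and its duality gap. -/

section Objective

variable {E F : Type*} [NormedAddCommGroup E] [InnerProductSpace ℝ E] [CompleteSpace E]
  [NormedAddCommGroup F] [InnerProductSpace ℝ F] [CompleteSpace F]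

/-- The assumptions on the objective. -/
structure RegularObjective (ℓ L ρ μ μx μy : ℝ) (f : E → F → ℝ) (Y : Set F) : Prop where
  L_nonneg : 0 ≤ L
  ρ_pos : 0 < ρ
  ρ_le : ρ ≤ ℓ
  μ_pos : 0 < μ
  μ_le : μ ≤ L + 2 * ρ
  μx_pos : 0 < μx
  μy_pos : 0 < μy
  closed : IsClosed Y
  convex : Convex ℝ Y
  grad : HasLipschitzGradOn ℓ f Y
  concave : ∀ x, StrongConcaveOn Y μy (f x)
  smooth : IsSmoothFun L (primal f Y)
  pl : SatisfiesPL μ (primal f Y)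
  plx : ∀ y ∈ Y, SatisfiesPL μx (fun x => f x y)
  weak : ∀ y ∈ Y, IsWeaklyConvex ρ (fun x => f x y)

/-- The value at `y` of the dual function of `f` regularized around `a`. -/
noncomputable def regDual (f : E → F → ℝ) (ρ : ℝ) (a : E) (y : F) : ℝ := ⨅ x : E, (f x y + ρ * ‖x - a‖ ^ 2)

/-- The duality gap of `f` regularized around `a`. -/
noncomputable def regGap (f : E → F → ℝ) (Y : Set F) (ρ : ℝ) (a x : E) (y : F) : ℝ :=
  primal f Y x + ρ * ‖x - a‖ ^ 2 - regDual f ρ a y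

/-- The minimum of the primal function. -/
noncomputable def primalMin (f : E → F → ℝ) (Y : Set F) : ℝ := ⨅ x : E, primal f Y x

namespace RegularObjective

variable {ℓ L ρ μ μx μy : ℝ} {f : E → F → ℝ} {Y : Set F}

lemma weak_le (h : RegularObjective ℓ L ρ μ μx μy f Y) {y : F} (hy : y ∈ Y) (x x' : E) :
    f x y + inner ℝ (gradX f x y) (x' - x) - ρ / 2 * ‖x' - x‖ ^ 2 ≤ f x' y := by
  have := h.weak y hy x' x
  simp only [gradX] at *
  linarith

lemma concave_le (h : RegularObjective ℓ L ρ μ μx μy f Y) {y y' : F} (hy : y ∈ Y) (hy' : y' ∈ Y)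
    (x : E) :
    f x y' ≤ f x y + inner ℝ (gradY f x y) (y' - y) - μy / 2 * ‖y' - y‖ ^ 2 :=
  StrongConcaveOn.le_of_differentiableAt (h.concave x) hy hy' (h.grad.1 x y hy).2

lemma lipschitz (h : RegularObjective ℓ L ρ μ μx μy f Y) {y y' : F} (hy : y ∈ Y) (hy' : y' ∈ Y)
    (x x' : E) : ‖gradX f x y - gradX f x' y'‖ ≤ ℓ * (‖x - x'‖ + ‖y - y'‖) ∧
      ‖gradY f x y - gradY f x' y'‖ ≤ ℓ * (‖x - x'‖ + ‖y - y'‖) := by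
  have hℓ : 0 ≤ ℓ := h.ρ_pos.le.trans h.ρ_le
  have h1 := h.grad.2 x x' y hy y' hy'
  have h2 : ℓ ^ 2 * (‖x - x'‖ ^ 2 + ‖y - y'‖ ^ 2) ≤ (ℓ * (‖x - x'‖ + ‖y - y'‖)) ^ 2 := by
    have : 0 ≤ ℓ ^ 2 * (‖x - x'‖ * ‖y - y'‖) := by positivity
    nlinarith
  constructor
  · refine abs_le_of_sq_le_sq' ?_ (by positivity) |>.2
    nlinarith [sq_nonneg ‖gradY f x y - gradY f x' y'‖]
  · refine abs_le_of_sq_le_sq' ?_ (by positivity) |>.2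
    nlinarith [sq_nonneg ‖gradX f x y - gradX f x' y'‖]

lemma continuous_left (h : RegularObjective ℓ L ρ μ μx μy f Y) {y : F} (hy : y ∈ Y) :
    Continuous fun x => f x y :=
  continuous_iff_continuousAt.2 fun x => (h.grad.1 x y hy).1.continuousAt

lemma continuousOn_right (h : RegularObjective ℓ L ρ μ μx μy f Y) (x : E) :
    ContinuousOn (f x) Y :=
  fun y hy => (h.grad.1 x y hy).2.continuousAt.continuousWithinAt

lemma bddAbove (h : RegularObjective ℓ L ρ μ μx μy f Y) {y : F} (hy : y ∈ Y) (x : E) :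
    BddAbove (Set.range fun y' : Y => f x y') := by
  refine ⟨f x y + ‖gradY f x y‖ ^ 2 / (2 * μy), ?_⟩
  rintro _ ⟨⟨y', hy'⟩, rfl⟩
  have h1 := h.concave_le hy hy' x
  have h2 := real_inner_le_norm (gradY f x y) (y' - y)
  have h3 : ‖gradY f x y‖ * ‖y' - y‖ - μy / 2 * ‖y' - y‖ ^ 2 ≤ ‖gradY f x y‖ ^ 2 / (2 * μy) := by
    have := h.μy_pos
    rw [le_div_iff₀ (by linarith)]
    nlinarith [sq_nonneg (‖gradY f x y‖ - μy * ‖y' - y‖)]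
  simp only
  linarith

lemma primal_le (h : RegularObjective ℓ L ρ μ μx μy f Y) {y : F} (hy : y ∈ Y) (x : E) :
    primal f Y x ≤ f x y + ‖gradY f x y‖ ^ 2 / (2 * μy) := by
  have : Nonempty Y := ⟨⟨y, hy⟩⟩
  refine ciSup_le ?_
  rintro ⟨y', hy'⟩
  have h1 := h.concave_le hy hy' x
  have h2 := real_inner_le_norm (gradY f x y) (y' - y)
  have h3 : ‖gradY f x y‖ * ‖y' - y‖ - μy / 2 * ‖y' - y‖ ^ 2 ≤ ‖gradY f x y‖ ^ 2 / (2 * μy) := by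
    have := h.μy_pos
    rw [le_div_iff₀ (by linarith)]
    nlinarith [sq_nonneg (‖gradY f x y‖ - μy * ‖y' - y‖)]
  simp only
  linarith

lemma le_primal (h : RegularObjective ℓ L ρ μ μx μy f Y) {y : F} (hy : y ∈ Y) (x : E) :
    f x y ≤ primal f Y x :=
  le_ciSup (h.bddAbove hy x) ⟨y, hy⟩

lemma primalMin_le (h : RegularObjective ℓ L ρ μ μx μy f Y) (x : E) :
    primalMin f Y ≤ primal f Y x := by
  obtain ⟨xs, hxs, -⟩ := h.pl
  exact ciInf_le ⟨primal f Y xs, by rintro _ ⟨x, rfl⟩; exact hxs x⟩ x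

lemma primal_pl (h : RegularObjective ℓ L ρ μ μx μy f Y) (x : E) :
    2 * μ * (primal f Y x - primalMin f Y) ≤ ‖gradient (primal f Y) x‖ ^ 2 := by
  obtain ⟨xs, hxs, hpl⟩ := h.pl
  have : primalMin f Y = primal f Y xs :=
    le_antisymm (h.primalMin_le xs) (le_ciInf hxs)
  rw [this]
  exact hpl x

lemma exists_dual (h : RegularObjective ℓ L ρ μ μx μy f Y) {y : F} (hy : y ∈ Y) :
    ∃ xs : E, (⨅ x, f x y) = f xs y ∧ (∀ x, f xs y ≤ f x y) ∧
      ∀ x, 2 * μx * (f x y - f xs y) ≤ ‖gradX f x y‖ ^ 2 := by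
  obtain ⟨xs, hxs, hpl⟩ := h.plx y hy
  exact ⟨xs, le_antisymm (ciInf_le ⟨f xs y, by rintro _ ⟨x, rfl⟩; exact hxs x⟩ xs) (le_ciInf hxs),
    hxs, hpl⟩

/-- `Y` may be unbounded; strong concavity pushes `f x` below its value at `y₀` far away, so the
maximum is attained. -/
lemma exists_argmax [FiniteDimensional ℝ F] (h : RegularObjective ℓ L ρ μ μx μy f Y) (hY : Y.Nonempty) (x : E) :
    ∃ y ∈ Y, primal f Y x = f x y ∧ ∀ y' ∈ Y, f x y' + μy / 2 * ‖y' - y‖ ^ 2 ≤ f x y := by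
  obtain ⟨y₀, hy₀⟩ := hY
  have : Nonempty Y := ⟨⟨y₀, hy₀⟩⟩
  obtain ⟨y, hy, hmax⟩ := (h.continuousOn_right x).exists_isMaxOn' h.closed hy₀ (by
    have h1 : ∀ᶠ y in Filter.cocompact F, 2 / μy * ‖gradY f x y₀‖ ≤ ‖y - y₀‖ := by
      have := (tendsto_norm_cocompact_atTop (E := F)).eventually_ge_atTop
        (2 / μy * ‖gradY f x y₀‖ + ‖y₀‖)
      filter_upwards [this] with y hy
      linarith [norm_sub_norm_le y y₀]
    filter_upwards [h1.filter_mono inf_le_left,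
      Filter.mem_inf_of_right (Filter.mem_principal_self Y)] with y hy hyY
    have h2 := h.concave_le hy₀ hyY x
    have h3 := real_inner_le_norm (gradY f x y₀) (y - y₀)
    have hμ := h.μy_pos
    have h4 : ‖gradY f x y₀‖ ≤ μy / 2 * ‖y - y₀‖ := by
      rw [div_mul_eq_mul_div, div_le_iff₀ hμ] at hy
      linarith
    nlinarith [norm_nonneg (y - y₀)])
  refine ⟨y, hy, le_antisymm (ciSup_le fun w => hmax w.2) (h.le_primal hy x), fun y' hy' => ?_⟩
  exact StrongConcaveOn.add_sq_le_of_isMax (h.concave x) hy hy' fun w hw => hmax hw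

variable [FiniteDimensional ℝ E]

/-- The regularizer has convexity modulus `2ρ`, of which weak convexity consumes `ρ`; the remaining
`ρ` gives coercivity, hence a minimizer, and the quadratic growth around it. Stationarity at the
minimizer gives the gradient formula. -/
lemma exists_prox (h : RegularObjective ℓ L ρ μ μx μy f Y) {y : F} (hy : y ∈ Y) (a : E) :
    ∃ xh : E, regDual f ρ a y = f xh y + ρ * ‖xh - a‖ ^ 2 ∧
      gradX f xh y = (2 * ρ) • (a - xh) ∧
      ∀ x, f xh y + ρ * ‖xh - a‖ ^ 2 + ρ / 2 * ‖x - xh‖ ^ 2 ≤ f x y + ρ * ‖x - a‖ ^ 2 := by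
  have hρ := h.ρ_pos
  have hcont : Continuous fun x => f x y + ρ * ‖x - a‖ ^ 2 :=
    (h.continuous_left hy).add (by fun_prop)
  obtain ⟨xh, hmin⟩ := hcont.exists_forall_le' a (by
    have h1 : ∀ᶠ x in Filter.cocompact E, 2 / ρ * ‖gradX f a y‖ ≤ ‖x - a‖ := by
      have := (tendsto_norm_cocompact_atTop (E := E)).eventually_ge_atTop
        (2 / ρ * ‖gradX f a y‖ + ‖a‖)
      filter_upwards [this] with x hx
      linarith [norm_sub_norm_le x a]
    filter_upwards [h1] with x hx
    have h2 := h.weak_le hy a x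
    have h3 := abs_le.1 (abs_real_inner_le_norm (gradX f a y) (x - a))
    have h4 : ‖gradX f a y‖ ≤ ρ / 2 * ‖x - a‖ := by
      rw [div_mul_eq_mul_div, div_le_iff₀ hρ] at hx
      linarith
    simp only [sub_self, norm_zero]
    nlinarith [norm_nonneg (x - a)])
  have hgrad : gradX f xh y = (2 * ρ) • (a - xh) := by
    have hf := (h.grad.1 xh y hy).1
    refine ext_inner_right ℝ fun v => ?_
    have h1 := hasDerivAt_comp_segment (g := fun x => f x y) v 0 (by simpa using hf)
    simp only [zero_smul, add_zero] at h1
    have h2 : HasDerivAt (fun s : ℝ => ρ * ‖xh + s • v - a‖ ^ 2) (ρ * (2 * inner ℝ (xh - a) v)) 0 := by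
      have h3 : HasDerivAt (fun s : ℝ => xh + s • v - a) v 0 := by
        simpa using (((hasDerivAt_id (0 : ℝ)).smul_const v).const_add xh).sub_const a
      simpa using h3.norm_sq.const_mul ρ
    have h4 : IsLocalMin (fun s : ℝ => f (xh + s • v) y + ρ * ‖xh + s • v - a‖ ^ 2) 0 :=
      Filter.Eventually.of_forall fun s => by simpa using hmin (xh + s • v)
    have h5 := h4.hasDerivAt_eq_zero (h1.add h2)
    rw [inner_smul_left]
    simp only [gradX, inner_sub_left, RCLike.conj_to_real] at *
    linarith
  refine ⟨xh, le_antisymm (ciInf_le ⟨_, by rintro _ ⟨x, rfl⟩; exact hmin x⟩ xh) (le_ciInf hmin),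
    hgrad, fun x => ?_⟩
  have h1 := h.weak_le hy xh x
  have e : ‖x - a‖ ^ 2 = ‖x - xh‖ ^ 2 - 2 * inner ℝ (a - xh) (x - xh) + ‖xh - a‖ ^ 2 := by
    rw [show x - a = (x - xh) - (a - xh) by abel, norm_sub_sq_real, real_inner_comm,
      norm_sub_rev a xh]
  rw [hgrad, inner_smul_left, RCLike.conj_to_real] at h1
  rw [e]
  linarith

lemma regDual_le (h : RegularObjective ℓ L ρ μ μx μy f Y) {y : F} (hy : y ∈ Y) (a x : E) :
    regDual f ρ a y ≤ f x y + ρ * ‖x - a‖ ^ 2 := by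
  obtain ⟨xh, h1, -, h2⟩ := h.exists_prox hy a
  have := h2 x
  have : 0 ≤ ρ / 2 * ‖x - xh‖ ^ 2 := by have := h.ρ_pos; positivity
  linarith

/-- The duality gap is controlled by the gap regularized around the point itself. -/
lemma dualityGap_le (h : RegularObjective ℓ L ρ μ μx μy f Y) {y : F} (hy : y ∈ Y) (x : E) :
    0 ≤ dualityGap f Y x y ∧
      dualityGap f Y x y ≤ 4 * (ρ / μx + 1) * regGap f Y ρ x x y := by
  obtain ⟨xs, hxs, hmin, hpl⟩ := h.exists_dual hy
  obtain ⟨xh, hxh, hgr, hq⟩ := h.exists_prox hy x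
  have hP := h.le_primal hy x
  have hρ := h.ρ_pos
  have hμ := h.μx_pos
  have hdef : dualityGap f Y x y = primal f Y x - f xs y := by rw [dualityGap, hxs]; rfl
  have hG : regGap f Y ρ x x y = primal f Y x - (f xh y + ρ * ‖xh - x‖ ^ 2) := by
    simp [regGap, hxh]
  have h1 := hpl xh
  rw [hgr, norm_smul, Real.norm_of_nonneg (by positivity), norm_sub_rev] at h1
  have h2 := hq x
  simp only [sub_self, norm_zero] at h2
  rw [norm_sub_rev x xh] at h2
  constructor
  · rw [hdef]; linarith [hmin x]
  · rw [hdef, hG]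
    -- The PL condition in `x` is applied at the proximal point, where the gradient is known to be
    -- `2ρ(x - xh)`; quadratic growth then bounds `‖xh - x‖²` by the regularized gap.
    have h3 : f xh y - f xs y ≤ 2 * (ρ / μx) * (ρ * ‖xh - x‖ ^ 2) := by
      have : 2 * (ρ / μx) * (ρ * ‖xh - x‖ ^ 2) = (2 * ρ * ‖xh - x‖) ^ 2 / (2 * μx) := by
        field_simp
      rw [this, le_div_iff₀ (by positivity)]
      linarith
    set G := primal f Y x - (f xh y + ρ * ‖xh - x‖ ^ 2) with hGd
    have h4 : ρ * ‖xh - x‖ ^ 2 ≤ 2 * G := by linarith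
    have h5 : 2 * (ρ / μx) * (ρ * ‖xh - x‖ ^ 2) ≤ 2 * (ρ / μx) * (2 * G) :=
      mul_le_mul_of_nonneg_left h4 (by positivity)
    have h6 : 0 ≤ ρ * ‖xh - x‖ ^ 2 := by positivity
    linarith

lemma regGap_nonneg (h : RegularObjective ℓ L ρ μ μx μy f Y) {y : F} (hy : y ∈ Y) (a x : E) :
    0 ≤ regGap f Y ρ a x y := by
  have h1 := h.regDual_le hy a x
  have h2 := h.le_primal hy x
  rw [regGap]; linarith

/-- Distances to the two best responses are controlled by the gaps at both ends of an epoch. -/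
lemma dist_best_response_le (h : RegularObjective ℓ L ρ μ μx μy f Y) {b y : F} (hb : b ∈ Y)
    (hy : y ∈ Y) (a x xh : E) (yh : F)
    (hxh : ∀ x, regDual f ρ a y + ρ / 2 * ‖x - xh‖ ^ 2 ≤ f x y + ρ * ‖x - a‖ ^ 2)
    (hyh : ∀ y' ∈ Y, f x y' + μy / 2 * ‖y' - yh‖ ^ 2 ≤ primal f Y x) :
    min ρ μy / 2 * (‖xh - a‖ ^ 2 + ‖yh - b‖ ^ 2) ≤ regGap f Y ρ a a b + regGap f Y ρ a x y := by
  have h1 := hxh a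
  have h2 := hyh b hb
  have h3 := h.le_primal hy a
  have h4 := h.regDual_le hb a x
  simp only [regGap, sub_self, norm_zero] at *
  rw [norm_sub_rev a xh] at h1
  rw [norm_sub_rev b yh] at h2
  have h5 : min ρ μy / 2 * ‖xh - a‖ ^ 2 ≤ ρ / 2 * ‖xh - a‖ ^ 2 := by
    gcongr; exact min_le_left _ _
  have h6 : min ρ μy / 2 * ‖yh - b‖ ^ 2 ≤ μy / 2 * ‖yh - b‖ ^ 2 := by
    gcongr; exact min_le_right _ _
  linarith

/-- The anchor itself is a competitor in the dual value, which is thus at most `f a y ≤ P(a)`.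
Travelling far in an epoch is possible only if `P` decreases or the gap is large. -/
lemma move_le (h : RegularObjective ℓ L ρ μ μx μy f Y) {y : F} (hy : y ∈ Y) (a x : E) :
    ρ * ‖x - a‖ ^ 2 ≤ primal f Y a - primal f Y x + regGap f Y ρ a x y := by
  have h1 := h.regDual_le hy a a
  have h2 := h.le_primal hy a
  simp only [regGap, sub_self, norm_zero] at *
  linarith

/-- The next epoch is anchored at `x` instead of `a`. The proximal point for the new anchor is a
competitor for the old one; Young's inequality leaves `ρ/4 ‖xh - x‖²`, which half of the new gap
absorbs. -/
lemma recenter_le (h : RegularObjective ℓ L ρ μ μx μy f Y) {y : F} (hy : y ∈ Y) (a x : E) :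
    regGap f Y ρ x x y ≤ 2 * regGap f Y ρ a x y + 8 * (ρ * ‖x - a‖ ^ 2) := by
  obtain ⟨xh, hxh, -, hq⟩ := h.exists_prox hy x
  have hρ := h.ρ_pos
  have h1 := h.regDual_le hy a xh
  have h2 := hq x
  have h3 := h.le_primal hy x
  have e : ‖xh - a‖ ^ 2 = ‖xh - x‖ ^ 2 + 2 * inner ℝ (xh - x) (x - a) + ‖x - a‖ ^ 2 := by
    rw [show xh - a = (xh - x) + (x - a) by abel, norm_add_sq_real]
  have h4 : 2 * inner ℝ (xh - x) (x - a) ≤ ‖xh - x‖ ^ 2 / 4 + 4 * ‖x - a‖ ^ 2 := by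
    nlinarith [real_inner_le_norm (xh - x) (x - a), sq_nonneg (‖xh - x‖ / 2 - 2 * ‖x - a‖)]
  have h5 := mul_le_mul_of_nonneg_left h4 hρ.le
  simp only [regGap, sub_self, norm_zero] at *
  rw [norm_sub_rev x xh] at h2
  rw [e] at h1
  nlinarith

/-- A gradient step of length `s` on `P + ρ‖· - a‖²` decreases it by at least `s/2 ‖w‖²`, and no
decrease can exceed the gap, since the dual value is a lower bound. -/
lemma grad_reg_sq_le (h : RegularObjective ℓ L ρ μ μx μy f Y) {y : F} (hy : y ∈ Y) (a x : E) :
    ‖gradient (primal f Y) x + (2 * ρ) • (x - a)‖ ^ 2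
      ≤ 4 * (L + 2 * ρ) * regGap f Y ρ a x y := by
  have hρ := h.ρ_pos
  have hL := h.L_nonneg
  set w := gradient (primal f Y) x + (2 * ρ) • (x - a) with hw
  set s : ℝ := 1 / (2 * (L + 2 * ρ)) with hs
  have hspos : 0 < s := by positivity
  have h1 := h.smooth.descent hL x (-(s • w))
  have h2 := h.regDual_le hy a (x + -(s • w))
  have h3 := h.le_primal hy (x + -(s • w))
  have e : ‖x + -(s • w) - a‖ ^ 2 = ‖x - a‖ ^ 2 - 2 * s * inner ℝ (x - a) w + s ^ 2 * ‖w‖ ^ 2 := by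
    rw [show x + -(s • w) - a = (x - a) - s • w by abel, norm_sub_sq_real, inner_smul_right,
      norm_smul, mul_pow, Real.norm_eq_abs, sq_abs]
    ring
  have e2 : inner ℝ (gradient (primal f Y) x) w + 2 * ρ * inner ℝ (x - a) w = ‖w‖ ^ 2 := by
    rw [← real_inner_self_eq_norm_sq, ← real_inner_smul_left, ← inner_add_left]
  rw [inner_neg_right, inner_smul_right, norm_neg, norm_smul, mul_pow, Real.norm_eq_abs, sq_abs]
    at h1
  rw [e] at h2
  have h4 : s * ‖w‖ ^ 2 - (L + ρ) * s ^ 2 * ‖w‖ ^ 2 ≤ regGap f Y ρ a x y := by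
    rw [regGap]
    have := congrArg (fun r => s * r) e2
    simp only [mul_add] at this
    nlinarith
  have h5 : (L + ρ) * s ^ 2 * ‖w‖ ^ 2 ≤ s / 2 * ‖w‖ ^ 2 := by
    have : (L + ρ) * s ≤ 1 / 2 := by
      rw [hs, mul_one_div, div_le_iff₀ (by positivity)]; linarith
    have h6 := mul_le_mul_of_nonneg_right this (by positivity : 0 ≤ s * ‖w‖ ^ 2)
    linarith
  have h6 : s / 2 * ‖w‖ ^ 2 ≤ regGap f Y ρ a x y := by linarith
  have h7 : 4 * (L + 2 * ρ) * (s / 2 * ‖w‖ ^ 2) = ‖w‖ ^ 2 := by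
    rw [hs]; field_simp; ring
  rw [← h7]
  gcongr

/-- By PL it suffices to bound `‖∇P(x)‖²`. The gradient is split into the regularized gradient,
controlled by the gap, and `2ρ(x - a)`, controlled by the decrease of `P`. -/
lemma pl_step (h : RegularObjective ℓ L ρ μ μx μy f Y) {y : F} (hy : y ∈ Y) (a x : E) :
    2 * μ * (primal f Y x - primalMin f Y)
      ≤ 8 * ρ * (primal f Y a - primal f Y x + regGap f Y ρ a x y)
        + 8 * (L + 2 * ρ) * regGap f Y ρ a x y := by
  have h1 := h.primal_pl x
  have h2 := h.grad_reg_sq_le hy a x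
  have h3 := h.move_le hy a x
  have hρ := h.ρ_pos
  have h4 : ‖gradient (primal f Y) x‖ ^ 2 ≤
      2 * ‖gradient (primal f Y) x + (2 * ρ) • (x - a)‖ ^ 2 + 8 * ρ * (ρ * ‖x - a‖ ^ 2) := by
    have e : gradient (primal f Y) x =
      (gradient (primal f Y) x + (2 * ρ) • (x - a)) - (2 * ρ) • (x - a) := by abel
    have h5 := norm_sub_le (gradient (primal f Y) x + (2 * ρ) • (x - a)) ((2 * ρ) • (x - a))
    rw [← e, norm_smul, Real.norm_of_nonneg (by positivity : 0 ≤ 2 * ρ)] at h5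
    have h6 := pow_le_pow_left₀ (norm_nonneg _) h5 2
    nlinarith [sq_nonneg (‖gradient (primal f Y) x + (2 * ρ) • (x - a)‖ - 2 * ρ * ‖x - a‖)]
  have h5 := mul_le_mul_of_nonneg_left h3 (by positivity : 0 ≤ 8 * ρ)
  linarith

end RegularObjective

end Objective

/-! ### The potential and its contraction over one epoch. -/

section Potential

variable {E F : Type*} [NormedAddCommGroup E] [InnerProductSpace ℝ E] [CompleteSpace E]
  [NormedAddCommGroup F] [InnerProductSpace ℝ F] [CompleteSpace F]
  {ℓ L ρ μ μx μy : ℝ} {f : E → F → ℝ} {Y : Set F}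

lemma one_sub_rate (L ρ μ : ℝ) (hc : cConst L ρ + 2 * μ ≠ 0) :
    1 - rate L ρ μ = cConst L ρ / (cConst L ρ + 2 * μ) := by
  rw [rate]; field_simp; ring

/-- The potential that contracts from epoch to epoch. -/
noncomputable def potential (f : E → F → ℝ) (Y : Set F) (L ρ μ : ℝ) (z : E × F) : ℝ :=
  (8 + 8 * ρ * (3 / (L + 2 * ρ)) + 2 * μ * (3 / (L + 2 * ρ))) *
    (primal f Y z.1 - primalMin f Y) + regGap f Y ρ z.1 z.1 z.2

/-- `lam` times `pl_step`, `recenter_le` and eight times `move_le` are added. The decrease of `P` on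
the right moves part of the weight to the new value of `P`, and the extra `2μ lam` there produces
the contraction. -/
lemma RegularObjective.potential_le [FiniteDimensional ℝ E]
    (h : RegularObjective ℓ L ρ μ μx μy f Y) {b y : F} (hb : b ∈ Y) (hy : y ∈ Y) (a x : E) (W : ℝ)
    (hW : 105 * regGap f Y ρ a x y ≤ regGap f Y ρ a a b + 106 * W) :
    potential f Y L ρ μ (x, y) ≤ (1 - rate L ρ μ) * potential f Y L ρ μ (a, b) + 46 / 105 * (106 * W) := by
  have hρ := h.ρ_pos
  have hμ := h.μ_pos
  have hL := h.L_nonneg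
  have hLh : 0 < L + 2 * ρ := by positivity
  set lam : ℝ := 3 / (L + 2 * ρ) with hlam
  have hlam0 : 0 < lam := by positivity
  have hLl : (L + 2 * ρ) * lam = 3 := by rw [hlam]; field_simp
  have h1 := mul_le_mul_of_nonneg_left (h.pl_step hy a x) hlam0.le
  have h2 := h.recenter_le hy a x
  have h3 := h.move_le hy a x
  have hV := sub_nonneg.2 (h.primalMin_le a)
  have hG := h.regGap_nonneg hb a a
  have hg := h.regGap_nonneg hy a x
  have hc : 0 < cConst L ρ := by rw [cConst]; positivity
  rw [one_sub_rate L ρ μ (by positivity)]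
  set q := cConst L ρ / (cConst L ρ + 2 * μ) with hq
  simp only [potential]
  rw [← hlam]
  set V := primal f Y a - primalMin f Y
  set V' := primal f Y x - primalMin f Y
  set G := regGap f Y ρ a a b
  set G' := regGap f Y ρ x x y
  set g := regGap f Y ρ a x y
  have e : primal f Y a - primal f Y x = V - V' := by simp only [V, V']; ring
  rw [e] at h1 h3
  have hρl : 2 * (ρ * lam) ≤ 3 := by nlinarith
  -- This amounts to `8 + 8ρ lam ≤ c lam`, where `c lam = 4ρ lam + 744/53`. It holds because `ρ lam
  -- ≤ 3/2` and `14 ≤ 744/53`; this is what the size of `c` is for.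
  have hA : 8 + 8 * ρ * lam ≤ q * (8 + 8 * ρ * lam + 2 * μ * lam) := by
    rw [hq, div_mul_eq_mul_div, le_div_iff₀ (by positivity)]
    have : 8 + 8 * ρ * lam ≤ cConst L ρ * lam := by
      rw [cConst, add_mul, mul_assoc (248 / 53), hLl]
      linarith
    nlinarith
  -- The new gap enters with coefficient at most `46 = 10 + 12 + 24`, and `epoch_le` gains 105; `μ ≤
  -- L + 2ρ` keeps `q` above the quotient.
  have hB : 46 / 105 ≤ q := by
    rw [hq, le_div_iff₀ (by positivity), cConst]
    linarith [h.μ_le]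
  have hsum : (8 + 8 * ρ * lam + 2 * μ * lam) * V' + G' ≤
      (8 + 8 * ρ * lam) * V + (10 + 8 * (ρ * lam) + 24) * g := by
    have : lam * (8 * (L + 2 * ρ) * g) = 24 * g := by linear_combination 8 * g * hLl
    nlinarith
  have hk : (10 + 8 * (ρ * lam) + 24) * g ≤ 46 * g :=
    mul_le_mul_of_nonneg_right (by linarith) hg
  have h4 := mul_le_mul_of_nonneg_right hA hV
  have h5 := mul_le_mul_of_nonneg_right hB hG
  linarith

end Potential

/-! ### Deterministic inequalities for a single step. -/

section Descent

variable {E : Type*} [NormedAddCommGroup E] [InnerProductSpace ℝ E]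

/-- The optimality condition is tested against `x₁ - u`, and `‖ηg + (x₁ - x₀)‖² ≥ 0` absorbs the
move from `x₀` to `x₁`. The regularizer leaves an extra `ρη` in front of `‖u - x₁‖²`. -/
lemma prox_step_le {ρ η : ℝ} {g x₀ x₁ a : E}
    (hx : η • g + (x₁ - x₀) + (2 * ρ * η) • (x₁ - a) = 0) (u : E) :
    η * inner ℝ g (x₀ - u) + ρ * η * ‖x₁ - a‖ ^ 2 - ρ * η * ‖u - a‖ ^ 2 ≤
      η ^ 2 / 2 * ‖g‖ ^ 2 + (1 / 2) * ‖u - x₀‖ ^ 2 - (1 / 2 + ρ * η) * ‖u - x₁‖ ^ 2 := by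
  have h1 := congrArg (fun v => inner ℝ v (x₁ - u)) hx
  simp only [inner_add_left, inner_smul_left, RCLike.conj_to_real, inner_zero_left] at h1
  have e1 : x₀ - u = (x₁ - u) - (x₁ - x₀) := by abel
  have e2 : ‖u - a‖ ^ 2 = ‖x₁ - a‖ ^ 2 - 2 * inner ℝ (x₁ - a) (x₁ - u) + ‖u - x₁‖ ^ 2 := by
    rw [show u - a = (x₁ - a) - (x₁ - u) by abel, norm_sub_sq_real, norm_sub_rev x₁ u]
  have e3 : ‖u - x₀‖ ^ 2 = ‖x₁ - x₀‖ ^ 2 - 2 * inner ℝ (x₁ - x₀) (x₁ - u) + ‖u - x₁‖ ^ 2 := by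
    rw [show u - x₀ = (x₁ - x₀) - (x₁ - u) by abel, norm_sub_sq_real, norm_sub_rev x₁ u]
  have h2 : 0 ≤ ‖η • g + (x₁ - x₀)‖ ^ 2 := by positivity
  rw [norm_add_sq_real, norm_smul, mul_pow, Real.norm_eq_abs, sq_abs, inner_smul_left,
    RCLike.conj_to_real] at h2
  rw [e1, inner_sub_right, e2, e3]
  nlinarith

lemma proj_step_le {η : ℝ} {g y₀ y₁ w : E}
    (hy : 0 ≤ inner ℝ (y₁ - y₀ - η • g) (w - y₁)) :
    η * inner ℝ g (w - y₀) ≤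
      η ^ 2 / 2 * ‖g‖ ^ 2 + (1 / 2) * ‖w - y₀‖ ^ 2 - (1 / 2) * ‖w - y₁‖ ^ 2 := by
  have e1 : w - y₀ = (w - y₁) + (y₁ - y₀) := by abel
  have h2 : 0 ≤ ‖η • g - (y₁ - y₀)‖ ^ 2 := by positivity
  rw [norm_sub_sq_real, norm_smul, mul_pow, Real.norm_eq_abs, sq_abs, inner_smul_left,
    RCLike.conj_to_real] at h2
  rw [inner_sub_left, inner_smul_left, RCLike.conj_to_real] at hy
  rw [e1, norm_add_sq_real, inner_add_right, real_inner_comm (y₁ - y₀) (w - y₁)]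
  linarith

lemma norm_proj_step_le {η : ℝ} (hη : 0 ≤ η) {g y₀ y₁ : E}
    (hy : 0 ≤ inner ℝ (y₁ - y₀ - η • g) (y₀ - y₁)) : ‖y₁ - y₀‖ ≤ η * ‖g‖ := by
  have e : y₀ - y₁ = -(y₁ - y₀) := by abel
  rw [e, inner_neg_right, inner_sub_left, real_inner_self_eq_norm_sq, inner_smul_left,
    RCLike.conj_to_real] at hy
  have h1 := mul_le_mul_of_nonneg_left (real_inner_le_norm g (y₁ - y₀)) hη
  by_contra! hlt
  have h0 : 0 ≤ η * ‖g‖ := by positivity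
  nlinarith

lemma norm_prox_step_sq_le {ρ η : ℝ} (hρ : 0 ≤ ρ) (hη : 0 ≤ η) {g x₀ x₁ a : E}
    (hx : η • g + (x₁ - x₀) + (2 * ρ * η) • (x₁ - a) = 0) :
    ‖x₁ - x₀‖ ^ 2 ≤ η ^ 2 * (2 * ‖g‖ ^ 2 + 8 * ρ ^ 2 * ‖x₀ - a‖ ^ 2) := by
  have hd : 1 ≤ 1 + 2 * ρ * η := by have : 0 ≤ 2 * ρ * η := by positivity
                                    linarith
  have e : (1 + 2 * ρ * η) • (x₁ - x₀) = -(η • (g + (2 * ρ) • (x₀ - a))) := by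
    rw [← sub_eq_zero, ← hx]; module
  have h1 : ‖x₁ - x₀‖ ≤ (1 + 2 * ρ * η) * ‖x₁ - x₀‖ :=
    le_mul_of_one_le_left (norm_nonneg _) hd
  have h2 := congrArg norm e
  rw [norm_smul, norm_neg, norm_smul, Real.norm_of_nonneg (by linarith), Real.norm_of_nonneg hη]
    at h2
  have h3 : ‖g + (2 * ρ) • (x₀ - a)‖ ≤ ‖g‖ + 2 * ρ * ‖x₀ - a‖ := by
    refine (norm_add_le _ _).trans_eq ?_
    rw [norm_smul, Real.norm_of_nonneg (by positivity)]
  have h4 : ‖x₁ - x₀‖ ≤ η * (‖g‖ + 2 * ρ * ‖x₀ - a‖) := by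
    rw [h2] at h1
    exact h1.trans (mul_le_mul_of_nonneg_left h3 hη)
  have h5 := pow_le_pow_left₀ (norm_nonneg _) h4 2
  refine h5.trans ?_
  rw [mul_pow]
  gcongr
  nlinarith [sq_nonneg (‖g‖ - 2 * ρ * ‖x₀ - a‖)]

/-- One proximal step moves towards `a - g / (2 ρ)`. -/
lemma sq_dist_prox_step_le {ρ η : ℝ} (hρ : 0 < ρ) (hη : 0 < η) {g x₀ x₁ a : E}
    (hx : η • g + (x₁ - x₀) + (2 * ρ * η) • (x₁ - a) = 0) :
    (1 + 2 * ρ * η) * (4 * ρ ^ 2 * ‖x₁ - a‖ ^ 2) ≤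
      4 * ρ ^ 2 * ‖x₀ - a‖ ^ 2 + 2 * ρ * η * ‖g‖ ^ 2 := by
  have hd : 0 < 1 + 2 * ρ * η := by positivity
  have e : (1 + 2 * ρ * η) • (x₁ - a) = (x₀ - a) - η • g := by
    rw [← sub_eq_zero, ← hx]; module
  have h1 := congrArg (fun v => ‖v‖ ^ 2) e
  simp only [norm_smul, mul_pow, Real.norm_eq_abs, sq_abs] at h1
  -- Convexity of the squared norm: `x₁ - a` is a weighted mean of `x₀ - a` and `-g/(2ρ)` with
  -- weights proportional to `1` and `2ρη`.
  have h2 : (2 * ρ) * ‖(x₀ - a) - η • g‖ ^ 2 ≤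
      (1 + 2 * ρ * η) * (2 * ρ * ‖x₀ - a‖ ^ 2 + η * ‖g‖ ^ 2) := by
    rw [norm_sub_sq_real, norm_smul, mul_pow, Real.norm_eq_abs, sq_abs, inner_smul_right]
    have h3 : 0 ≤ ‖(2 * ρ) • (x₀ - a) + g‖ ^ 2 := by positivity
    rw [norm_add_sq_real, norm_smul, mul_pow, Real.norm_eq_abs, sq_abs, inner_smul_left,
      RCLike.conj_to_real] at h3
    have h4 := mul_nonneg hη.le h3
    nlinarith
  rw [← h1] at h2
  have h5 : (1 + 2 * ρ * η) * ((1 + 2 * ρ * η) * (4 * ρ ^ 2 * ‖x₁ - a‖ ^ 2)) ≤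
      (1 + 2 * ρ * η) * (4 * ρ ^ 2 * ‖x₀ - a‖ ^ 2 + 2 * ρ * η * ‖g‖ ^ 2) := by
    nlinarith
  exact le_of_mul_le_mul_left h5 hd

/-- Jensen's inequality for an average, from a supporting hyperplane at the average. -/
lemma jensen_of_support {T : ℕ} (hT : T ≠ 0) {p : ℕ → E} {xb g : E} {φ₀ : ℝ} {φ : ℕ → ℝ}
    (hxb : xb = (1 / (T : ℝ)) • ∑ t ∈ Finset.range T, p t)
    (hφ : ∀ s, φ₀ + inner ℝ g (p s - xb) ≤ φ s) :
    T * φ₀ ≤ ∑ s ∈ Finset.range T, φ s := by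
  subst hxb
  have h := Finset.sum_le_sum fun s (_ : s ∈ Finset.range T) => hφ s
  rw [Finset.sum_add_distrib, ← inner_sum, Finset.sum_sub_distrib] at h
  simp only [Finset.sum_const, Finset.card_range] at h
  rw [← Nat.cast_smul_eq_nsmul ℝ, ← Nat.cast_smul_eq_nsmul ℝ, smul_smul,
    mul_one_div_cancel (by exact_mod_cast hT), one_smul, sub_self, inner_zero_right, add_zero] at h
  simpa using h

end Descent

/-! ### One epoch along a fixed sample path. -/

section Run

variable {E F : Type*} [NormedAddCommGroup E] [InnerProductSpace ℝ E]
  [NormedAddCommGroup F] [InnerProductSpace ℝ F]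

/-- Optimality conditions of the iterates of one epoch with stochastic gradients `gx`, `gy`. -/
structure IsEpochRun (Y : Set F) (ρ η : ℝ) (a : E) (b : F) (x gx : ℕ → E) (y gy : ℕ → F) :
    Prop where
  x_zero : x 0 = a
  y_zero : y 0 = b
  y_mem : ∀ s, y s ∈ Y
  x_step : ∀ s, η • gx s + (x (s + 1) - x s) + (2 * ρ * η) • (x (s + 1) - a) = 0
  y_step : ∀ s, ∀ w ∈ Y, 0 ≤ inner ℝ (y (s + 1) - y s - η • gy s) (w - y (s + 1))

/-- The coefficient of the second-order part of the noise. -/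
noncomputable def noiseCoeff (ℓ ρ μy : ℝ) : ℝ := 2 * ℓ + ℓ ^ 2 / (2 * μy) + ℓ ^ 2 / (2 * ρ)

/-- The squared terms of the noise of one step. -/
noncomputable def sqNoise (ℓ ρ μy η : ℝ) (a x gx dx : E) (gy dy : F) : ℝ :=
  η / 2 * (‖gx‖ ^ 2 + ‖gy‖ ^ 2 + ‖dx‖ ^ 2 + ‖dy‖ ^ 2)
    + (η / 2 + noiseCoeff ℓ ρ μy * η ^ 2)
      * (2 * ‖gx‖ ^ 2 + 8 * ρ ^ 2 * ‖x - a‖ ^ 2 + ‖gy‖ ^ 2)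

/-- The noise of one epoch; `dx`, `dy` stand for the exact gradients at the iterates. -/
noncomputable def epochNoise (ℓ ρ μy η : ℝ) (T : ℕ) (a : E) (b : F) (x gx dx : ℕ → E) (y gy dy : ℕ → F) : ℝ :=
  (1 / (T : ℝ)) * (∑ s ∈ Finset.range T, inner ℝ (dx s - gx s) (x s - a)
    + ∑ s ∈ Finset.range T, inner ℝ (dy s - gy s) (b - y s)
    + η / 2 * ‖∑ s ∈ Finset.range T, (dx s - gx s)‖ ^ 2
    + η / 2 * ‖∑ s ∈ Finset.range T, (dy s - gy s)‖ ^ 2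
    + ∑ s ∈ Finset.range T, sqNoise ℓ ρ μy η a (x s) (gx s) (dx s) (gy s) (dy s))

lemma inner_le_of_quadratic {η : ℝ} (hη : 0 < η) (S v : E) :
    η * inner ℝ S v ≤ η * (η / 2 * ‖S‖ ^ 2) + 1 / 2 * ‖v‖ ^ 2 := by
  have h1 := real_inner_le_norm S v
  nlinarith [sq_nonneg (η * ‖S‖ - ‖v‖)]

variable [CompleteSpace E] [CompleteSpace F] {ℓ L ρ μ μx μy : ℝ} {f : E → F → ℝ} {Y : Set F}

/-- The one-step inequality of the stochastic gradient method. -/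
lemma RegularObjective.step_le (h : RegularObjective ℓ L ρ μ μx μy f Y) {η : ℝ} (hη : 0 < η)
    {a x₀ x₁ gx u : E} {y₀ y₁ gy w : F} (hy₀ : y₀ ∈ Y) (hy₁ : y₁ ∈ Y) (hw : w ∈ Y)
    (hx : η • gx + (x₁ - x₀) + (2 * ρ * η) • (x₁ - a) = 0)
    (hy : ∀ w ∈ Y, 0 ≤ inner ℝ (y₁ - y₀ - η • gy) (w - y₁)) :
    η * (f x₁ w + ρ * ‖x₁ - a‖ ^ 2 - (f u y₁ + ρ * ‖u - a‖ ^ 2)) ≤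
      (1 / 2 + ρ * η) * (‖u - x₀‖ ^ 2 - ‖u - x₁‖ ^ 2) + 1 / 2 * (‖w - y₀‖ ^ 2 - ‖w - y₁‖ ^ 2)
      + η * inner ℝ (gradX f x₀ y₀ - gx) (x₀ - u) + η * inner ℝ (gradY f x₀ y₀ - gy) (w - y₀)
      + η * sqNoise ℓ ρ μy η a x₀ gx (gradX f x₀ y₀) gy (gradY f x₀ y₀) := by
  have hρ := h.ρ_pos
  have hμy := h.μy_pos
  have hℓ : 0 ≤ ℓ := hρ.le.trans h.ρ_le
  have hK : 0 ≤ noiseCoeff ℓ ρ μy := by rw [noiseCoeff]; positivity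
  have p1 := prox_step_le hx u
  have p2 := proj_step_le (hy w hw)
  have p3 := norm_proj_step_le hη.le (hy y₀ hy₀)
  have p4 := norm_prox_step_sq_le hρ.le hη.le hx
  have q1 := h.weak_le hy₀ x₀ u
  have q2 := h.concave_le hy₀ hw x₀
  have q3 := h.weak_le hw x₁ x₀
  have q4 := h.concave_le hy₁ hy₀ u
  have l1 := (h.lipschitz hw hy₀ x₁ x₀).1
  have l2 := (h.lipschitz hy₁ hy₀ u x₀).2
  set d := ‖x₁ - x₀‖ with hd
  set e := ‖y₁ - y₀‖ with he
  set dx := gradX f x₀ y₀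
  set dy := gradY f x₀ y₀
  have r1 : -inner ℝ (gradX f x₁ w) (x₀ - x₁) ≤ (‖dx‖ + ℓ * (d + ‖w - y₀‖)) * d := by
    rw [← inner_neg_right, neg_sub]
    refine (real_inner_le_norm _ _).trans ?_
    gcongr
    calc ‖gradX f x₁ w‖ = ‖dx + (gradX f x₁ w - dx)‖ := by abel_nf
      _ ≤ _ := (norm_add_le _ _).trans (by gcongr)
  have r2 : inner ℝ (gradY f u y₁) (y₀ - y₁) ≤ (‖dy‖ + ℓ * (‖u - x₀‖ + e)) * e := by
    refine (real_inner_le_norm _ _).trans ?_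
    rw [norm_sub_rev y₀ y₁]
    gcongr
    calc ‖gradY f u y₁‖ = ‖dy + (gradY f u y₁ - dy)‖ := by abel_nf
      _ ≤ _ := (norm_add_le _ _).trans (by gcongr)
  -- Gradients are taken at `z₀` but the gap is measured at `z₁`, which creates the mixed terms `s1`
  -- and `s2`. The first is absorbed by the strong concavity kept in `q2`.
  have s1 : ℓ * ‖w - y₀‖ * d ≤ μy / 2 * ‖w - y₀‖ ^ 2 + ℓ ^ 2 / (2 * μy) * d ^ 2 := by
    have : 0 ≤ (μy * ‖w - y₀‖ - ℓ * d) ^ 2 / (2 * μy) := by positivity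
    have e' : (μy * ‖w - y₀‖ - ℓ * d) ^ 2 / (2 * μy) =
      μy / 2 * ‖w - y₀‖ ^ 2 + ℓ ^ 2 / (2 * μy) * d ^ 2 - ℓ * ‖w - y₀‖ * d := by field_simp; ring
    linarith
  have s2 : ℓ * ‖u - x₀‖ * e ≤ ρ / 2 * ‖u - x₀‖ ^ 2 + ℓ ^ 2 / (2 * ρ) * e ^ 2 := by
    have : 0 ≤ (ρ * ‖u - x₀‖ - ℓ * e) ^ 2 / (2 * ρ) := by positivity
    have e' : (ρ * ‖u - x₀‖ - ℓ * e) ^ 2 / (2 * ρ) =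
      ρ / 2 * ‖u - x₀‖ ^ 2 + ℓ ^ 2 / (2 * ρ) * e ^ 2 - ℓ * ‖u - x₀‖ * e := by field_simp; ring
    linarith
  have t1 : η * (‖dx‖ * d) ≤ η * (η / 2 * ‖dx‖ ^ 2) + 1 / 2 * d ^ 2 := by
    linarith [sq_nonneg (η * ‖dx‖ - d)]
  have t2 : η * (‖dy‖ * e) ≤ η * (η / 2 * ‖dy‖ ^ 2) + 1 / 2 * e ^ 2 := by
    linarith [sq_nonneg (η * ‖dy‖ - e)]
  have u1 : f x₁ w - f x₀ w ≤ ‖dx‖ * d + μy / 2 * ‖w - y₀‖ ^ 2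
      + noiseCoeff ℓ ρ μy * d ^ 2 := by
    have h1 : ρ / 2 * d ^ 2 ≤ ℓ * d ^ 2 := by
      have := h.ρ_le
      gcongr; linarith
    have h2 : 0 ≤ ℓ ^ 2 / (2 * ρ) * d ^ 2 := by positivity
    rw [norm_sub_rev x₀ x₁] at q3
    rw [noiseCoeff]
    linarith
  have u2 : f u y₀ - f u y₁ ≤ ‖dy‖ * e + ρ / 2 * ‖u - x₀‖ ^ 2 + noiseCoeff ℓ ρ μy * e ^ 2 := by
    have h1 : 0 ≤ μy / 2 * ‖y₀ - y₁‖ ^ 2 := by positivity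
    have h2 : 0 ≤ ℓ ^ 2 / (2 * μy) * e ^ 2 := by positivity
    have h3 : 0 ≤ ℓ * e ^ 2 := by positivity
    rw [noiseCoeff]
    linarith
  -- Weak convexity and `s2` each cost `ρ/2 ‖u - x₀‖²`. Multiplied by `η`, their sum raises the
  -- coefficient of `‖u - x₀‖²` to that of `‖u - x₁‖²`, so the distances telescope.
  have v1 : f x₁ w - f u y₁ ≤ ‖dx‖ * d + ‖dy‖ * e + noiseCoeff ℓ ρ μy * (d ^ 2 + e ^ 2)
      + ρ * ‖u - x₀‖ ^ 2 + inner ℝ dx (x₀ - u) + inner ℝ dy (w - y₀) := by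
    rw [← neg_sub x₀ u, inner_neg_right] at q1
    rw [neg_sub] at q1
    linarith
  have v2 := mul_le_mul_of_nonneg_left v1 hη.le
  have p5 : e ^ 2 ≤ η ^ 2 * ‖gy‖ ^ 2 := by
    rw [← mul_pow]; exact pow_le_pow_left₀ (norm_nonneg _) p3 2
  have v3 : (1 / 2 + noiseCoeff ℓ ρ μy * η) * (d ^ 2 + e ^ 2) ≤ (1 / 2 + noiseCoeff ℓ ρ μy * η) *
      (η ^ 2 * (2 * ‖gx‖ ^ 2 + 8 * ρ ^ 2 * ‖x₀ - a‖ ^ 2) + η ^ 2 * ‖gy‖ ^ 2) := by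
    gcongr
  rw [inner_sub_left, inner_sub_left, sqNoise]
  linarith

/-- Summed inequality over an epoch, against fixed comparison points. -/
lemma RegularObjective.sum_step_le (h : RegularObjective ℓ L ρ μ μx μy f Y) {η : ℝ} (hη : 0 < η)
    (hη1 : ρ * η ≤ 1) {a : E} {b : F} {x gx : ℕ → E} {y gy : ℕ → F}
    (hr : IsEpochRun Y ρ η a b x gx y gy) {T : ℕ} (hT : T ≠ 0) (u : E) {w : F} (hw : w ∈ Y) :
    η * ∑ s ∈ Finset.range T, (f (x (s + 1)) w + ρ * ‖x (s + 1) - a‖ ^ 2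
        - (f u (y (s + 1)) + ρ * ‖u - a‖ ^ 2)) ≤
      2 * (‖u - a‖ ^ 2 + ‖w - b‖ ^ 2) + η * (T * epochNoise ℓ ρ μy η T a b x gx
        (fun s => gradX f (x s) (y s)) y gy (fun s => gradY f (x s) (y s))) := by
  have hsum := Finset.sum_le_sum fun s (_ : s ∈ Finset.range T) =>
    h.step_le hη (u := u) (hr.y_mem s) (hr.y_mem (s + 1)) hw (hr.x_step s) (hr.y_step s)
  -- `u` and `w` may depend on all samples of the epoch. Splitting at the starting point leaves a
  -- martingale transform and the whole sum of deviations tested against `a - u` or `w - b`, which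
  -- Young's inequality handles.
  have e1 : ∀ s, inner ℝ (gradX f (x s) (y s) - gx s) (x s - u) =
      inner ℝ (gradX f (x s) (y s) - gx s) (x s - a)
        + inner ℝ (gradX f (x s) (y s) - gx s) (a - u) := fun s => by
    rw [← inner_add_right]; congr 1; abel
  have e2 : ∀ s, inner ℝ (gradY f (x s) (y s) - gy s) (w - y s) =
      inner ℝ (gradY f (x s) (y s) - gy s) (b - y s)
        + inner ℝ (gradY f (x s) (y s) - gy s) (w - b) := fun s => by
    rw [← inner_add_right]; congr 1; abel
  simp only [e1, e2, Finset.sum_add_distrib, mul_add, ← Finset.mul_sum] at hsum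
  rw [Finset.sum_range_sub' (fun s => ‖u - x s‖ ^ 2), Finset.sum_range_sub' (fun s => ‖w - y s‖ ^ 2),
    ← sum_inner, ← sum_inner, hr.x_zero, hr.y_zero] at hsum
  have i1 := inner_le_of_quadratic hη (∑ s ∈ Finset.range T, (gradX f (x s) (y s) - gx s)) (a - u)
  have i2 := inner_le_of_quadratic hη (∑ s ∈ Finset.range T, (gradY f (x s) (y s) - gy s)) (w - b)
  rw [norm_sub_rev a u] at i1
  have hTW : ∀ r : ℝ, (T : ℝ) * (1 / (T : ℝ) * r) = r := fun r => by
    rw [← mul_assoc, mul_one_div_cancel (by exact_mod_cast hT), one_mul]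
  rw [epochNoise, hTW]
  have j1 : (1 / 2 + ρ * η) * (‖u - a‖ ^ 2 - ‖u - x T‖ ^ 2) ≤ 3 / 2 * ‖u - a‖ ^ 2 := by
    have := h.ρ_pos
    have h1 : 0 ≤ (1 / 2 + ρ * η) * ‖u - x T‖ ^ 2 := by positivity
    have h2 : (1 / 2 + ρ * η) * ‖u - a‖ ^ 2 ≤ 3 / 2 * ‖u - a‖ ^ 2 := by gcongr; linarith
    linarith
  have j2 : 0 ≤ ‖w - y T‖ ^ 2 := by positivity
  have j3 : 0 ≤ ‖w - b‖ ^ 2 := by positivity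
  have e3 : η * ∑ s ∈ Finset.range T, (f (x (s + 1)) w + ρ * ‖x (s + 1) - a‖ ^ 2
        - (f u (y (s + 1)) + ρ * ‖u - a‖ ^ 2)) = ∑ s ∈ Finset.range T,
        η * (f (x (s + 1)) w + ρ * ‖x (s + 1) - a‖ ^ 2
        - (f u (y (s + 1)) + ρ * ‖u - a‖ ^ 2)) := Finset.mul_sum _ _ _
  simp only [mul_add] at hsum ⊢
  linarith

/-- The regularized gap after an epoch. -/
lemma RegularObjective.epoch_le [FiniteDimensional ℝ E] [FiniteDimensional ℝ F]
    (h : RegularObjective ℓ L ρ μ μx μy f Y) {η : ℝ} (hη : 0 < η)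
    (hη1 : ρ * η ≤ 1) {a : E} {b : F} {x gx : ℕ → E} {y gy : ℕ → F}
    (hr : IsEpochRun Y ρ η a b x gx y gy) {T : ℕ} (hT : 424 ≤ η * T * min ρ μy)
    {xb : E} {yb : F} (hyb : yb ∈ Y) (hxb' : xb = (1 / (T : ℝ)) • ∑ s ∈ Finset.range T, x (s + 1))
    (hyb' : yb = (1 / (T : ℝ)) • ∑ s ∈ Finset.range T, y (s + 1)) :
    105 * regGap f Y ρ a xb yb ≤ regGap f Y ρ a a b + 106 * epochNoise ℓ ρ μy η T a b x gx
        (fun s => gradX f (x s) (y s)) y gy (fun s => gradY f (x s) (y s)) := by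
  have hρ := h.ρ_pos
  have hm : 0 < min ρ μy := lt_min hρ h.μy_pos
  have hT0 : T ≠ 0 := by rintro rfl; norm_num at hT
  have hTpos : (0 : ℝ) < T := by exact_mod_cast Nat.pos_of_ne_zero hT0
  have hb : b ∈ Y := hr.y_zero ▸ hr.y_mem 0
  obtain ⟨xh, hxh, -, hxq⟩ := h.exists_prox hyb a
  obtain ⟨yh, hyh, hP, hyq⟩ := h.exists_argmax ⟨b, hb⟩ xb
  have h1 := h.sum_step_le hη hη1 hr hT0 xh hyh
  have hdist := h.dist_best_response_le hb hyb a xb xh yh (fun x => by rw [hxh]; exact hxq x)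
    (fun y' hy' => by rw [hP]; exact hyq y' hy')
  set W := epochNoise ℓ ρ μy η T a b x gx
        (fun s => gradX f (x s) (y s)) y gy (fun s => gradY f (x s) (y s))
  have hJ1 : T * (f xb yh + ρ * ‖xb - a‖ ^ 2) ≤
      ∑ s ∈ Finset.range T, (f (x (s + 1)) yh + ρ * ‖x (s + 1) - a‖ ^ 2) := by
    refine jensen_of_support hT0 hxb' (g := gradX f xb yh + (2 * ρ) • (xb - a)) fun s => ?_
    rw [inner_add_left, inner_smul_left, RCLike.conj_to_real]
    have := h.weak_le hyh xb (x (s + 1))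
    have e : ‖x (s + 1) - a‖ ^ 2 = ‖x (s + 1) - xb‖ ^ 2
        + 2 * inner ℝ (xb - a) (x (s + 1) - xb) + ‖xb - a‖ ^ 2 := by
      rw [show x (s + 1) - a = (x (s + 1) - xb) + (xb - a) by abel, norm_add_sq_real,
        real_inner_comm]
    have h2 : 0 ≤ ρ * ‖x (s + 1) - xb‖ ^ 2 := by positivity
    rw [e]
    linarith
  have hJ2 : ∑ s ∈ Finset.range T, f xh (y (s + 1)) ≤ T * f xh yb := by
    have := jensen_of_support hT0 hyb' (φ₀ := -f xh yb) (φ := fun s => -f xh (y (s + 1)))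
      (g := -gradY f xh yb) fun s => by
        rw [inner_neg_left]
        have := h.concave_le hyb (hr.y_mem (s + 1)) xh
        have : 0 ≤ μy / 2 * ‖y (s + 1) - yb‖ ^ 2 := by have := h.μy_pos; positivity
        linarith
    rw [Finset.sum_neg_distrib] at this
    linarith
  have hgap : regGap f Y ρ a xb yb = f xb yh + ρ * ‖xb - a‖ ^ 2
      - (f xh yb + ρ * ‖xh - a‖ ^ 2) := by rw [regGap, hP, hxh]
  have h2 : T * regGap f Y ρ a xb yb ≤ ∑ s ∈ Finset.range T, (f (x (s + 1)) yh
      + ρ * ‖x (s + 1) - a‖ ^ 2 - (f xh (y (s + 1)) + ρ * ‖xh - a‖ ^ 2)) := by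
    rw [Finset.sum_sub_distrib, Finset.sum_add_distrib (f := fun s => f xh (y (s + 1)))]
    simp only [Finset.sum_const, Finset.card_range, nsmul_eq_mul]
    rw [hgap]
    linarith
  have h3 := mul_le_mul_of_nonneg_left h2 hη.le
  set g := regGap f Y ρ a xb yb
  set G := regGap f Y ρ a a b
  set D := ‖xh - a‖ ^ 2 + ‖yh - b‖ ^ 2
  -- `sum_step_le` bounds the gap by `2D/(ηT) + W`, and `424 = 4 · 106` makes the first term at most
  -- `(G + g)/106`; solving for `g` leaves the factor 105.
  have h4 : 424 * D ≤ η * T * (2 * (G + g)) := by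
    have hD : 0 ≤ D := by positivity
    calc 424 * D ≤ η * T * min ρ μy * D := mul_le_mul_of_nonneg_right hT hD
      _ = η * T * (2 * (min ρ μy / 2 * D)) := by ring
      _ ≤ _ := by gcongr
  have h5 : η * T * (105 * g) ≤ η * T * (G + 106 * W) := by nlinarith
  exact le_of_mul_le_mul_left h5 (by positivity)

end Run

/-! ### Closed form of the SGDA step. -/

section Step

variable {E F : Type*} [NormedAddCommGroup E] [InnerProductSpace ℝ E]
  [NormedAddCommGroup F] [InnerProductSpace ℝ F]

/-- The nearest point of `Y`, characterized by its variational inequality. -/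
noncomputable def nearest (Y : Set F) (u : F) : F :=
  Classical.epsilon fun v => v ∈ Y ∧ ∀ w ∈ Y, inner ℝ (u - v) (w - v) ≤ 0

lemma nearest_spec [CompleteSpace F] {Y : Set F} (hne : Y.Nonempty) (hc : IsClosed Y)
    (hY : Convex ℝ Y) (u : F) :
    nearest Y u ∈ Y ∧ ∀ w ∈ Y, inner ℝ (u - nearest Y u) (w - nearest Y u) ≤ 0 := by
  obtain ⟨v, hv, hv'⟩ := exists_norm_eq_iInf_of_complete_convex hne hc.isComplete hY u
  exact Classical.epsilon_spec (p := fun v => v ∈ Y ∧ ∀ w ∈ Y, inner ℝ (u - v) (w - v) ≤ 0)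
    ⟨v, hv, (norm_eq_iInf_iff_real_inner_le_zero hY hv).1 hv'⟩

/-- Continuity of the projection is what makes the iterates measurable. -/
lemma lipschitz_nearest [CompleteSpace F] {Y : Set F} (hne : Y.Nonempty) (hc : IsClosed Y)
    (hY : Convex ℝ Y) : LipschitzWith 1 (nearest Y) := by
  refine LipschitzWith.of_dist_le_mul fun u v => ?_
  obtain ⟨hu, hu'⟩ := nearest_spec hne hc hY u
  obtain ⟨hv, hv'⟩ := nearest_spec hne hc hY v
  have h1 := hu' _ hv
  have h2 := hv' _ hu
  rw [NNReal.coe_one, one_mul, dist_eq_norm, dist_eq_norm]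
  set p := nearest Y u
  set q := nearest Y v
  have e1 : inner ℝ (u - p) (q - p) = - inner ℝ (u - p) (p - q) := by
    rw [← inner_neg_right, neg_sub]
  have e2 : inner ℝ (u - v) (p - q) = inner ℝ (u - p) (p - q) + ‖p - q‖ ^ 2
      - inner ℝ (v - q) (p - q) := by
    rw [← real_inner_self_eq_norm_sq, ← inner_add_left, ← inner_sub_left]
    congr 1; abel
  have h3 := real_inner_le_norm (u - v) (p - q)
  by_contra! hlt
  nlinarith [norm_nonneg (u - v)]

/-- Explicit form of the step of the method. -/
noncomputable def explicitStep (Y : Set F) (γ η : ℝ) (x₀ : E) (zbar g : E × F) : E × F :=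
  ((1 + γ * η)⁻¹ • (zbar.1 + (γ * η) • x₀ - η • g.1), nearest Y (zbar.2 + η • g.2))

lemma explicitStep_fst {Y : Set F} {γ η : ℝ} (h : 0 ≤ γ * η) (x₀ : E) (zbar g : E × F) :
    η • g.1 + ((explicitStep Y γ η x₀ zbar g).1 - zbar.1)
      + (γ * η) • ((explicitStep Y γ η x₀ zbar g).1 - x₀) = 0 := by
  have hd : 1 + γ * η ≠ 0 := by positivity
  have e : (1 + γ * η) • (explicitStep Y γ η x₀ zbar g).1 = zbar.1 + (γ * η) • x₀ - η • g.1 := by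
    rw [explicitStep, smul_inv_smul₀ hd]
  rw [← sub_eq_zero] at e
  rw [← e]; module

/-- `sgdaStep` is an arbitrary choice among minimizers. The step objective grows quadratically
around the explicit point, so there is exactly one minimizer and the choice is forced. -/
lemma sgdaStep_eq [CompleteSpace F] {Y : Set F} (hne : Y.Nonempty) (hc : IsClosed Y)
    (hY : Convex ℝ Y) {γ η : ℝ} (h : 0 ≤ γ * η) (x₀ : E) (zbar g : E × F) :
    sgdaStep Y γ η x₀ zbar g = explicitStep Y γ η x₀ zbar g := by
  set z := explicitStep Y γ η x₀ zbar g with hz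
  obtain ⟨hy, hy'⟩ := nearest_spec hne hc hY (zbar.2 + η • g.2)
  have hx := explicitStep_fst (Y := Y) h x₀ zbar g
  have key : ∀ w : E × F, w.2 ∈ Y → stepObjective γ η x₀ zbar g z
      + (‖w.1 - z.1‖ ^ 2 + ‖w.2 - z.2‖ ^ 2) / 2 ≤ stepObjective γ η x₀ zbar g w := by
    intro w hw
    have h1 := congrArg (fun v => inner ℝ v (w.1 - z.1)) hx
    have h2 := hy' w.2 hw
    change inner ℝ (zbar.2 + η • g.2 - z.2) (w.2 - z.2) ≤ 0 at h2
    rw [← hz] at h1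
    simp only [inner_add_left, inner_smul_left, RCLike.conj_to_real, inner_zero_left] at h1
    rw [show zbar.2 + η • g.2 - z.2 = η • g.2 - (z.2 - zbar.2) by abel, inner_sub_left,
      inner_smul_left, RCLike.conj_to_real] at h2
    have e1 : ‖w.1 - zbar.1‖ ^ 2 = ‖w.1 - z.1‖ ^ 2 + 2 * inner ℝ (z.1 - zbar.1) (w.1 - z.1)
        + ‖z.1 - zbar.1‖ ^ 2 := by
      rw [show w.1 - zbar.1 = (w.1 - z.1) + (z.1 - zbar.1) by abel, norm_add_sq_real,
        real_inner_comm]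
    have e2 : ‖w.2 - zbar.2‖ ^ 2 = ‖w.2 - z.2‖ ^ 2 + 2 * inner ℝ (z.2 - zbar.2) (w.2 - z.2)
        + ‖z.2 - zbar.2‖ ^ 2 := by
      rw [show w.2 - zbar.2 = (w.2 - z.2) + (z.2 - zbar.2) by abel, norm_add_sq_real,
        real_inner_comm]
    have e3 : ‖w.1 - x₀‖ ^ 2 = ‖w.1 - z.1‖ ^ 2 + 2 * inner ℝ (z.1 - x₀) (w.1 - z.1)
        + ‖z.1 - x₀‖ ^ 2 := by
      rw [show w.1 - x₀ = (w.1 - z.1) + (z.1 - x₀) by abel, norm_add_sq_real,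
        real_inner_comm]
    have e4 : inner ℝ g.1 (w.1 - z.1) = inner ℝ g.1 w.1 - inner ℝ g.1 z.1 := inner_sub_right _ _ _
    have e5 : inner ℝ g.2 (w.2 - z.2) = inner ℝ g.2 w.2 - inner ℝ g.2 z.2 := inner_sub_right _ _ _
    rw [e4] at h1
    rw [e5] at h2
    simp only [stepObjective]
    rw [e1, e2, e3]
    have h3 : 0 ≤ γ * η / 2 * ‖w.1 - z.1‖ ^ 2 := by positivity
    linarith
  have hex : ∃ z : E × F, z.2 ∈ Y ∧ ∀ w : E × F, w.2 ∈ Y →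
      stepObjective γ η x₀ zbar g z ≤ stepObjective γ η x₀ zbar g w :=
    ⟨z, hy, fun w hw => by
      have := key w hw
      have : 0 ≤ (‖w.1 - z.1‖ ^ 2 + ‖w.2 - z.2‖ ^ 2) / 2 := by positivity
      linarith⟩
  obtain ⟨h1, h2⟩ := Classical.epsilon_spec hex
  have h3 := h2 z hy
  have h4 := key _ h1
  rw [sgdaStep]
  set v := Classical.epsilon fun z : E × F => z.2 ∈ Y ∧ ∀ w : E × F, w.2 ∈ Y →
      stepObjective γ η x₀ zbar g z ≤ stepObjective γ η x₀ zbar g w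
  have h5 : ‖v.1 - z.1‖ ^ 2 = 0 := by nlinarith [sq_nonneg ‖v.1 - z.1‖, sq_nonneg ‖v.2 - z.2‖]
  have h6 : ‖v.2 - z.2‖ ^ 2 = 0 := by nlinarith [sq_nonneg ‖v.1 - z.1‖, sq_nonneg ‖v.2 - z.2‖]
  exact Prod.ext (sub_eq_zero.1 (norm_eq_zero.1 (pow_eq_zero_iff two_ne_zero |>.1 h5)))
    (sub_eq_zero.1 (norm_eq_zero.1 (pow_eq_zero_iff two_ne_zero |>.1 h6)))

variable {Ξ : Type*} [CompleteSpace F]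

lemma isEpochRun_sgdaIter {Y : Set F} (hc : IsClosed Y)
    (hY : Convex ℝ Y) {ρ η : ℝ} (h : 0 ≤ ρ * η) (G : E × F → Ξ → E × F) {z₀ : E × F}
    (hz₀ : z₀.2 ∈ Y) (ξ : ℕ → Ξ) :
    IsEpochRun Y ρ η z₀.1 z₀.2 (fun s => (sgdaIter Y (2 * ρ) η G z₀ ξ s).1)
      (fun s => (G (sgdaIter Y (2 * ρ) η G z₀ ξ s) (ξ s)).1)
      (fun s => (sgdaIter Y (2 * ρ) η G z₀ ξ s).2)
      (fun s => (G (sgdaIter Y (2 * ρ) η G z₀ ξ s) (ξ s)).2) := by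
  have h' : 0 ≤ 2 * ρ * η := by linarith
  have hne : Y.Nonempty := ⟨_, hz₀⟩
  have hstep : ∀ s, sgdaIter Y (2 * ρ) η G z₀ ξ (s + 1) = explicitStep Y (2 * ρ) η z₀.1
      (sgdaIter Y (2 * ρ) η G z₀ ξ s) (G (sgdaIter Y (2 * ρ) η G z₀ ξ s) (ξ s)) := fun s => by
    rw [sgdaIter, sgdaStep_eq hne hc hY h']
  refine ⟨rfl, rfl, fun s => ?_, fun s => ?_, fun s w hw => ?_⟩
  · cases s with
    | zero => exact hz₀
    | succ s => simp only [hstep]; exact (nearest_spec hne hc hY _).1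
  · simp only [hstep]; exact explicitStep_fst h' _ _ _
  · have := (nearest_spec hne hc hY ((sgdaIter Y (2 * ρ) η G z₀ ξ s).2
      + η • (G (sgdaIter Y (2 * ρ) η G z₀ ξ s) (ξ s)).2)).2 w hw
    simp only [hstep]
    rw [← neg_nonneg, ← inner_neg_left, neg_sub, ← sub_sub] at this
    exact this

lemma sgdaEpoch_mem {Y : Set F} (hc : IsClosed Y)
    (hY : Convex ℝ Y) {ρ η : ℝ} (h : 0 ≤ ρ * η) (G : E × F → Ξ → E × F) {z₀ : E × F}
    (hz₀ : z₀.2 ∈ Y) (ξ : ℕ → Ξ) {T : ℕ} (hT : T ≠ 0) :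
    (sgdaEpoch Y (2 * ρ) η T G z₀ ξ).2 ∈ Y := by
  have hr := isEpochRun_sgdaIter hc hY h G hz₀ ξ
  rw [sgdaEpoch, Prod.smul_snd, Prod.snd_sum, Finset.smul_sum]
  have hT' : (T : ℝ) ≠ 0 := by exact_mod_cast hT
  refine hY.sum_mem (fun _ _ => by positivity) ?_ fun s _ => hr.y_mem (s + 1)
  simp [hT']

end Step

/-! ### Square-integrable random vectors. -/

section Moments

variable {Ω : Type*} {mΩ : MeasurableSpace Ω} {P : Measure Ω}
  {V : Type*} [NormedAddCommGroup V] [InnerProductSpace ℝ V]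

omit [InnerProductSpace ℝ V] in
lemma integrable_sq_norm {g : Ω → V} (hg : MemLp g 2 P) : Integrable (fun ω => ‖g ω‖ ^ 2) P :=
  (memLp_two_iff_integrable_sq_norm hg.1).1 hg

lemma integrable_inner_of_memLp {g v : Ω → V} (hg : MemLp g 2 P) (hv : MemLp v 2 P) :
    Integrable (fun ω => inner ℝ (g ω) (v ω)) P := by
  refine ((integrable_sq_norm hg).add (integrable_sq_norm hv)).mono (hg.1.inner hv.1)
    (Filter.Eventually.of_forall fun ω => ?_)
  rw [Real.norm_eq_abs, Pi.add_apply, Real.norm_of_nonneg (by positivity)]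
  refine (abs_real_inner_le_norm _ _).trans ?_
  nlinarith [sq_nonneg (‖g ω‖ - ‖v ω‖), sq_nonneg ‖g ω‖, sq_nonneg ‖v ω‖]

omit [InnerProductSpace ℝ V] in
/-- A bound of the second moment as a lower integral. -/
lemma memLp_of_lintegral_sq_le {g : Ω → V} (hg : AEStronglyMeasurable g P) {c : ℝ} (hc : 0 ≤ c)
    (h : ∫⁻ ω, ‖g ω‖ₑ ^ 2 ∂P ≤ ENNReal.ofReal c) :
    MemLp g 2 P ∧ ∫ ω, ‖g ω‖ ^ 2 ∂P ≤ c := by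
  have e : ∀ ω, ‖‖g ω‖ ^ 2‖ₑ = ‖g ω‖ₑ ^ 2 := fun ω => by rw [enorm_pow, enorm_norm]
  have hint : Integrable (fun ω => ‖g ω‖ ^ 2) P := by
    refine ⟨hg.norm.pow 2, ?_⟩
    rw [HasFiniteIntegral]
    simp only [e]
    exact h.trans_lt ENNReal.ofReal_lt_top
  refine ⟨(memLp_two_iff_integrable_sq_norm hg).2 hint, ?_⟩
  have h1 := ofReal_integral_norm_eq_lintegral_enorm hint
  simp only [e] at h1
  rw [← h1] at h
  simpa using (ENNReal.ofReal_le_ofReal_iff hc).1 h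

lemma enorm_integral_sq_le [IsProbabilityMeasure P] {g : Ω → V}
    (hg : AEStronglyMeasurable g P) : ‖∫ ω, g ω ∂P‖ₑ ^ 2 ≤ ∫⁻ ω, ‖g ω‖ₑ ^ 2 ∂P := by
  have h1 : eLpNorm g 1 P ≤ eLpNorm g 2 P := eLpNorm_le_eLpNorm_of_exponent_le (by norm_num) hg
  have h2 := eLpNorm_nnreal_pow_eq_lintegral (f := g) (μ := P) (p := 2) two_ne_zero
  calc ‖∫ ω, g ω ∂P‖ₑ ^ 2 ≤ (eLpNorm g 1 P) ^ 2 := by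
        rw [eLpNorm_one_eq_lintegral_enorm]
        gcongr
        exact enorm_integral_le_lintegral_enorm g
    _ ≤ (eLpNorm g 2 P) ^ 2 := by gcongr
    _ = _ := by simpa using h2

end Moments

/-! ### A stochastic oracle queried with a fresh sample. -/

section Query

variable {Ω Ξ Z V : Type*} {m mΩ : MeasurableSpace Ω} {mΞ : MeasurableSpace Ξ}
  [MeasurableSpace Z] [NormedAddCommGroup V] [InnerProductSpace ℝ V]
  [MeasurableSpace V] [BorelSpace V] [SecondCountableTopology V]

/-- A fresh sample `ζ`, independent of the past `m`. -/
structure FreshSample (m : MeasurableSpace Ω) {mΩ : MeasurableSpace Ω} (P : Measure Ω)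
    (D : Measure Ξ) (ζ : Ω → Ξ) : Prop where
  le : m ≤ mΩ
  meas : Measurable ζ
  indep : Indep m (MeasurableSpace.comap ζ mΞ) P
  law : Measure.map ζ P = D

variable {P : Measure Ω} {D : Measure Ξ} {ζ : Ω → Ξ}
  [IsProbabilityMeasure P] [IsProbabilityMeasure D]

omit [IsProbabilityMeasure D] in
lemma FreshSample.map_prod (h : FreshSample m P D ζ) {U : Ω → Z} (hU : Measurable[m] U) :
    Measure.map (fun ω => (U ω, ζ ω)) P = (Measure.map U P).prod D := by
  have hU' : Measurable U := hU.mono h.le le_rfl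
  rw [← h.law, ← indepFun_iff_map_prod_eq_prod_map_map hU'.aemeasurable h.meas.aemeasurable,
    IndepFun_iff_Indep]
  exact indep_of_indep_of_le_left h.indep hU.comap_le

lemma FreshSample.lintegral_eq (h : FreshSample m P D ζ) {U : Ω → Z} (hU : Measurable[m] U)
    {φ : Z × Ξ → ENNReal} (hφ : Measurable φ) :
    ∫⁻ ω, φ (U ω, ζ ω) ∂P = ∫⁻ ω, ∫⁻ s, φ (U ω, s) ∂D ∂P := by
  have hU' : Measurable U := hU.mono h.le le_rfl
  rw [← lintegral_map hφ (hU'.prodMk h.meas), h.map_prod hU, lintegral_prod _ hφ.aemeasurable,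
    lintegral_map hφ.lintegral_prod_right' hU']

lemma FreshSample.integral_eq (h : FreshSample m P D ζ) {U : Ω → Z} (hU : Measurable[m] U)
    {φ : Z × Ξ → ℝ} (hφ : Measurable φ) (hi : Integrable (fun ω => φ (U ω, ζ ω)) P) :
    ∫ ω, φ (U ω, ζ ω) ∂P = ∫ ω, ∫ s, φ (U ω, s) ∂D ∂P := by
  have hU' : Measurable U := hU.mono h.le le_rfl
  have hpair : Measurable fun ω => (U ω, ζ ω) := hU'.prodMk h.meas
  have hi' := (integrable_map_measure hφ.aestronglyMeasurable hpair.aemeasurable).2 hi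
  rw [← integral_map (f := φ) hpair.aemeasurable hφ.aestronglyMeasurable]
  rw [h.map_prod hU] at hi' ⊢
  rw [integral_prod _ hi', integral_map hU'.aemeasurable]
  exact hφ.stronglyMeasurable.integral_prod_right'.aestronglyMeasurable

/-- A stochastic oracle `H`, queried at a random point `z` with a fresh sample. -/
structure IsQuery (m : MeasurableSpace Ω) {mΩ : MeasurableSpace Ω} (P : Measure Ω)
    (D : Measure Ξ) (ζ : Ω → Ξ) (B : ℝ) (H : Z × Ξ → V) (z : Ω → Z) : Prop where
  fresh : FreshSample m P D ζ
  measH : Measurable H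
  measz : Measurable[m] z
  integrable : ∀ ω, Integrable (fun s => H (z ω, s)) D
  bound : ∫⁻ ω, ‖H (z ω, ζ ω)‖ₑ ^ 2 ∂P ≤ ENNReal.ofReal (B ^ 2)

namespace IsQuery

variable {B : ℝ} {H : Z × Ξ → V} {z : Ω → Z}

omit [InnerProductSpace ℝ V] [BorelSpace V] [SecondCountableTopology V]
  [IsProbabilityMeasure P] [IsProbabilityMeasure D] in
lemma measurable_value (q : IsQuery m P D ζ B H z) : Measurable fun ω => H (z ω, ζ ω) :=
  q.measH.comp ((q.measz.mono q.fresh.le le_rfl).prodMk q.fresh.meas)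

omit [IsProbabilityMeasure P] in
lemma measurable_mean (q : IsQuery m P D ζ B H z) : Measurable[m] fun ω => ∫ s, H (z ω, s) ∂D :=
  q.measH.stronglyMeasurable.integral_prod_right'.measurable.comp q.measz

omit [InnerProductSpace ℝ V] [IsProbabilityMeasure P]
  [IsProbabilityMeasure D] in
lemma memLp_value (q : IsQuery m P D ζ B H z) :
    MemLp (fun ω => H (z ω, ζ ω)) 2 P ∧ ∫ ω, ‖H (z ω, ζ ω)‖ ^ 2 ∂P ≤ B ^ 2 :=
  memLp_of_lintegral_sq_le q.measurable_value.aestronglyMeasurable (sq_nonneg B) q.bound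

lemma memLp_mean (q : IsQuery m P D ζ B H z) :
    MemLp (fun ω => ∫ s, H (z ω, s) ∂D) 2 P ∧ ∫ ω, ‖∫ s, H (z ω, s) ∂D‖ ^ 2 ∂P ≤ B ^ 2 := by
  refine memLp_of_lintegral_sq_le
    (q.measurable_mean.mono q.fresh.le le_rfl).aestronglyMeasurable (sq_nonneg B) ?_
  -- Conditional Jensen: with the past frozen, the square of the mean is at most the mean of the
  -- square. The exact gradients thus inherit the bound `B²`.
  refine le_trans (lintegral_mono fun ω => enorm_integral_sq_le
    (q.integrable ω).aestronglyMeasurable) ?_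
  rw [← q.fresh.lintegral_eq q.measz (φ := fun p => ‖H p‖ₑ ^ 2) (q.measH.enorm.pow_const 2)]
  exact q.bound

lemma memLp_dev (q : IsQuery m P D ζ B H z) :
    MemLp (fun ω => (∫ s, H (z ω, s) ∂D) - H (z ω, ζ ω)) 2 P ∧
      ∫ ω, ‖(∫ s, H (z ω, s) ∂D) - H (z ω, ζ ω)‖ ^ 2 ∂P ≤ 4 * B ^ 2 := by
  have h1 := q.memLp_value
  have h2 := q.memLp_mean
  have hm := h2.1.sub h1.1
  refine ⟨hm, ?_⟩
  have i1 := (integrable_sq_norm h1.1).const_mul 2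
  have i2 := (integrable_sq_norm h2.1).const_mul 2
  refine (integral_mono (integrable_sq_norm hm) (i2.add i1) fun ω => ?_).trans ?_
  · have := norm_sub_le (∫ s, H (z ω, s) ∂D) (H (z ω, ζ ω))
    have := pow_le_pow_left₀ (norm_nonneg _) this 2
    simp only [Pi.add_apply, Pi.sub_apply]
    nlinarith [sq_nonneg (‖∫ s, H (z ω, s) ∂D‖ - ‖H (z ω, ζ ω)‖)]
  · simp only [Pi.add_apply]
    rw [integral_add i2 i1, integral_const_mul, integral_const_mul]
    linarith [h1.2, h2.2]

/-- The deviation from the mean is orthogonal to the past. -/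
lemma integral_inner_dev (q : IsQuery m P D ζ B H z) [CompleteSpace V] {v : Ω → V}
    (hv : Measurable[m] v) (hv2 : MemLp v 2 P) :
    ∫ ω, inner ℝ ((∫ s, H (z ω, s) ∂D) - H (z ω, ζ ω)) (v ω) ∂P = 0 := by
  have hi := integrable_inner_of_memLp q.memLp_dev.1 hv2
  have hmean : Measurable fun u : Z => ∫ s, H (u, s) ∂D :=
    q.measH.stronglyMeasurable.integral_prod_right'.measurable
  have hφ : Measurable fun p : (Z × V) × Ξ =>
      (inner ℝ ((∫ s, H (p.1.1, s) ∂D) - H (p.1.1, p.2)) p.1.2 : ℝ) := by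
    refine Measurable.inner (Measurable.sub ?_ ?_) (by fun_prop)
    · exact hmean.comp (by fun_prop)
    · exact q.measH.comp (by fun_prop)
  -- The query point and the test vector are both known from the past, so they are frozen together
  -- while the sample is integrated out.
  rw [q.fresh.integral_eq (q.measz.prodMk hv) (φ := fun p : (Z × V) × Ξ =>
      (inner ℝ ((∫ s, H (p.1.1, s) ∂D) - H (p.1.1, p.2)) p.1.2 : ℝ)) hφ hi]
  refine integral_eq_zero_of_ae (Filter.Eventually.of_forall fun ω => ?_)
  have h1 : Integrable (fun s => (∫ s, H (z ω, s) ∂D) - H (z ω, s)) D :=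
    (integrable_const _).sub (q.integrable ω)
  simp only [Pi.zero_apply]
  have h2 := integral_inner (𝕜 := ℝ) h1 (v ω)
  simp only [real_inner_comm _ (v ω)] at h2 ⊢
  rw [h2, integral_sub (integrable_const _) (q.integrable ω)]
  simp

end IsQuery

end Query

/-! ### Sums of martingale differences. -/

section Sequence

variable {Ω Ξ Z V : Type*} {mΩ : MeasurableSpace Ω} {mΞ : MeasurableSpace Ξ} [MeasurableSpace Z]
  [NormedAddCommGroup V] [InnerProductSpace ℝ V] [MeasurableSpace V]
  [BorelSpace V] [SecondCountableTopology V]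
  {P : Measure Ω} {D : Measure Ξ} {m : ℕ → MeasurableSpace Ω} {ζ : ℕ → Ω → Ξ}
  [IsProbabilityMeasure P] [IsProbabilityMeasure D]
  {B : ℝ} {H : Z × Ξ → V} {z : ℕ → Ω → Z}

variable [CompleteSpace V]

/-- Second moment of a sum of martingale differences. -/
lemma memLp_sum_dev (hm : Monotone m) (hζ : ∀ s, Measurable[m (s + 1)] (ζ s)) {T : ℕ}
    (q : ∀ s < T, IsQuery (m s) P D (ζ s) B H (z s)) (n : ℕ) (hn : n ≤ T) :
    Measurable[m n] (fun ω => ∑ s ∈ Finset.range n, ((∫ r, H (z s ω, r) ∂D) - H (z s ω, ζ s ω))) ∧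
    MemLp (fun ω => ∑ s ∈ Finset.range n, ((∫ r, H (z s ω, r) ∂D) - H (z s ω, ζ s ω))) 2 P ∧
    ∫ ω, ‖∑ s ∈ Finset.range n, ((∫ r, H (z s ω, r) ∂D) - H (z s ω, ζ s ω))‖ ^ 2 ∂P
      ≤ n * (4 * B ^ 2) := by
  induction n with
  | zero => simp
  | succ n ih =>
    obtain ⟨i1, i2, i3⟩ := ih (by omega)
    have hq := q n (by omega)
    have hd := hq.memLp_dev
    simp only [Finset.sum_range_succ]
    refine ⟨?_, i2.add hd.1, ?_⟩
    · have hz : Measurable[m (n + 1)] (z n) := hq.measz.mono (hm n.le_succ) le_rfl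
      refine Measurable.add (i1.mono (hm n.le_succ) le_rfl) (Measurable.sub
        (hq.measurable_mean.mono (hm n.le_succ) le_rfl) ?_)
      exact hq.measH.comp (hz.prodMk (hζ n))
    · simp only [norm_add_sq_real]
      have j := integrable_inner_of_memLp hd.1 i2
      have j0 := hq.integral_inner_dev i1 i2
      simp only [real_inner_comm _ (∑ s ∈ Finset.range n, _)] at j j0 ⊢
      have hs : Integrable (fun ω =>
          ‖∑ s ∈ Finset.range n, ((∫ r, H (z s ω, r) ∂D) - H (z s ω, ζ s ω))‖ ^ 2
          + 2 * inner ℝ ((∫ r, H (z n ω, r) ∂D) - H (z n ω, ζ n ω))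
            (∑ s ∈ Finset.range n, ((∫ r, H (z s ω, r) ∂D) - H (z s ω, ζ s ω)))) P :=
        (integrable_sq_norm i2).add (j.const_mul 2)
      rw [integral_add hs (integrable_sq_norm hd.1), integral_add (integrable_sq_norm i2) (j.const_mul 2), integral_const_mul, j0]
      push_cast
      linarith [hd.2]

lemma integral_sum_inner_dev {T : ℕ} (q : ∀ s < T, IsQuery (m s) P D (ζ s) B H (z s))
    {v : ℕ → Ω → V} (hv : ∀ s < T, Measurable[m s] (v s)) (hv2 : ∀ s < T, MemLp (v s) 2 P) :
    Integrable (fun ω => ∑ s ∈ Finset.range T,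
      inner ℝ ((∫ r, H (z s ω, r) ∂D) - H (z s ω, ζ s ω)) (v s ω)) P ∧
    ∫ ω, ∑ s ∈ Finset.range T,
      inner ℝ ((∫ r, H (z s ω, r) ∂D) - H (z s ω, ζ s ω)) (v s ω) ∂P = 0 := by
  have hi : ∀ s ∈ Finset.range T, Integrable (fun ω =>
      inner ℝ ((∫ r, H (z s ω, r) ∂D) - H (z s ω, ζ s ω)) (v s ω)) P := fun s hs =>
    integrable_inner_of_memLp (q s (Finset.mem_range.1 hs)).memLp_dev.1
      (hv2 s (Finset.mem_range.1 hs))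
  refine ⟨integrable_finsetSum _ hi, ?_⟩
  rw [integral_finsetSum _ hi]
  exact Finset.sum_eq_zero fun s hs => (q s (Finset.mem_range.1 hs)).integral_inner_dev
    (hv s (Finset.mem_range.1 hs)) (hv2 s (Finset.mem_range.1 hs))

end Sequence

/-! ### Expected noise of one epoch. -/

section StochasticEpoch

variable {Ω Ξ E F : Type*} {mΩ : MeasurableSpace Ω} {mΞ : MeasurableSpace Ξ}
  [NormedAddCommGroup E] [InnerProductSpace ℝ E] [MeasurableSpace E]
  [BorelSpace E] [SecondCountableTopology E]
  [NormedAddCommGroup F] [InnerProductSpace ℝ F] [MeasurableSpace F]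
  [BorelSpace F] [SecondCountableTopology F]

/-- An epoch run with a stochastic oracle and fresh samples, adapted to the past `m`. -/
structure IsStochasticEpoch (m : ℕ → MeasurableSpace Ω) {mΩ : MeasurableSpace Ω} (P : Measure Ω)
    (D : Measure Ξ) (Y : Set F) (ρ η B : ℝ) (T : ℕ) (Gx : (E × F) × Ξ → E) (Gy : (E × F) × Ξ → F)
    (z₀ : Ω → E × F) (z : ℕ → Ω → E × F) (ζ : ℕ → Ω → Ξ) : Prop where
  mono : Monotone m
  sample_meas : ∀ s, Measurable[m (s + 1)] (ζ s)
  start_meas : Measurable[m 0] z₀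
  queryX : ∀ s < T, IsQuery (m s) P D (ζ s) B Gx (z s)
  queryY : ∀ s < T, IsQuery (m s) P D (ζ s) B Gy (z s)
  run : ∀ ω, IsEpochRun Y ρ η (z₀ ω).1 (z₀ ω).2 (fun s => (z s ω).1)
    (fun s => Gx (z s ω, ζ s ω)) (fun s => (z s ω).2) (fun s => Gy (z s ω, ζ s ω))

namespace IsStochasticEpoch

variable {P : Measure Ω} {D : Measure Ξ} {m : ℕ → MeasurableSpace Ω} {ζ : ℕ → Ω → Ξ} {Y : Set F} {ρ η B : ℝ} {T : ℕ}
  {Gx : (E × F) × Ξ → E} {Gy : (E × F) × Ξ → F} {z₀ : Ω → E × F} {z : ℕ → Ω → E × F}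

omit [BorelSpace F] [SecondCountableTopology F] in
lemma measurable_fst_sub (h : IsStochasticEpoch m P D Y ρ η B T Gx Gy z₀ z ζ) {s : ℕ}
    (hs : s < T) : Measurable[m s] fun ω => (z s ω).1 - (z₀ ω).1 :=
  (measurable_fst.comp (h.queryX s hs).measz).sub
    (measurable_fst.comp (h.start_meas.mono (h.mono s.zero_le) le_rfl))

omit [BorelSpace E] [SecondCountableTopology E] in
lemma measurable_snd_sub (h : IsStochasticEpoch m P D Y ρ η B T Gx Gy z₀ z ζ) {s : ℕ}
    (hs : s < T) : Measurable[m s] fun ω => (z₀ ω).2 - (z s ω).2 :=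
  (measurable_snd.comp (h.start_meas.mono (h.mono s.zero_le) le_rfl)).sub
    (measurable_snd.comp (h.queryX s hs).measz)

omit [BorelSpace F] [SecondCountableTopology F] in
-- With `e s = 4ρ² E‖x_s - a‖²`, the regularization gives `(1 + 2ρη) e (s + 1) ≤ e s + 2ρη B²`, so
-- the bound `B²` propagates from `e 0 = 0`. It does not grow with the length of the epoch.
lemma memLp_fst_sub (h : IsStochasticEpoch m P D Y ρ η B T Gx Gy z₀ z ζ) (hρ : 0 < ρ)
    (hη : 0 < η) (s : ℕ) (hs : s < T) :
    MemLp (fun ω => (z s ω).1 - (z₀ ω).1) 2 P ∧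
      4 * ρ ^ 2 * ∫ ω, ‖(z s ω).1 - (z₀ ω).1‖ ^ 2 ∂P ≤ B ^ 2 := by
  induction s with
  | zero =>
    have e : ∀ ω, (z 0 ω).1 - (z₀ ω).1 = 0 := fun ω => sub_eq_zero.2 (h.run ω).x_zero
    simp [e, sq_nonneg]
  | succ s ih =>
    obtain ⟨i1, i2⟩ := ih (by omega)
    have hq := (h.queryX s (by omega)).memLp_value
    have hstep : ∀ ω, (1 + 2 * ρ * η) * (4 * ρ ^ 2 * ‖(z (s + 1) ω).1 - (z₀ ω).1‖ ^ 2) ≤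
        4 * ρ ^ 2 * ‖(z s ω).1 - (z₀ ω).1‖ ^ 2 + 2 * ρ * η * ‖Gx (z s ω, ζ s ω)‖ ^ 2 := fun ω =>
      sq_dist_prox_step_le hρ hη ((h.run ω).x_step s)
    have hmeas : AEStronglyMeasurable (fun ω => (z (s + 1) ω).1 - (z₀ ω).1) P :=
      ((h.measurable_fst_sub hs).mono (h.queryX _ hs).fresh.le le_rfl).aestronglyMeasurable
    have hb : Integrable (fun ω => 4 * ρ ^ 2 * ‖(z s ω).1 - (z₀ ω).1‖ ^ 2
        + 2 * ρ * η * ‖Gx (z s ω, ζ s ω)‖ ^ 2) P :=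
      ((integrable_sq_norm i1).const_mul _).add ((integrable_sq_norm hq.1).const_mul _)
    have hd : 0 < 2 * ρ * η := by positivity
    have hi : Integrable (fun ω => (1 + 2 * ρ * η) * (4 * ρ ^ 2
        * ‖(z (s + 1) ω).1 - (z₀ ω).1‖ ^ 2)) P := by
      refine hb.mono (((hmeas.norm.pow 2).const_mul _).const_mul _)
        (Filter.Eventually.of_forall fun ω => ?_)
      rw [Real.norm_of_nonneg (by positivity), Real.norm_of_nonneg (by positivity)]
      exact hstep ω
    have hi' : Integrable (fun ω => ‖(z (s + 1) ω).1 - (z₀ ω).1‖ ^ 2) P := by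
      refine (hi.const_mul ((1 + 2 * ρ * η) * (4 * ρ ^ 2))⁻¹).congr
        (Filter.Eventually.of_forall fun ω => ?_)
      simp only
      field_simp
    refine ⟨(memLp_two_iff_integrable_sq_norm hmeas).2 hi', ?_⟩
    have hint := integral_mono hi hb hstep
    rw [integral_add ((integrable_sq_norm i1).const_mul _) ((integrable_sq_norm hq.1).const_mul _),
      integral_const_mul, integral_const_mul, integral_const_mul, integral_const_mul] at hint
    have h1 := mul_le_mul_of_nonneg_left hq.2 hd.le
    refine le_of_mul_le_mul_left (hint.trans ?_) (by linarith : 0 < 1 + 2 * ρ * η)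
    linarith

omit [BorelSpace E] [SecondCountableTopology E] in
-- Only finiteness of the second moment is needed, to make the martingale transform in `y`
-- integrable; its size never enters.
lemma memLp_snd_sub (h : IsStochasticEpoch m P D Y ρ η B T Gx Gy z₀ z ζ)
    (hη : 0 < η) (s : ℕ) (hs : s < T) :
    MemLp (fun ω => (z₀ ω).2 - (z s ω).2) 2 P := by
  induction s with
  | zero =>
    have e : ∀ ω, (z₀ ω).2 - (z 0 ω).2 = 0 := fun ω => sub_eq_zero.2 (h.run ω).y_zero.symm
    simp [e]
  | succ s ih =>
    have i1 := ih (by omega)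
    have hq := (h.queryY s (by omega)).memLp_value
    have hmeas : AEStronglyMeasurable (fun ω => (z₀ ω).2 - (z (s + 1) ω).2) P :=
      ((h.measurable_snd_sub hs).mono (h.queryX _ hs).fresh.le le_rfl).aestronglyMeasurable
    refine (i1.norm.add (hq.1.norm.const_mul η)).of_le hmeas
      (Filter.Eventually.of_forall fun ω => ?_)
    have h1 := norm_proj_step_le hη.le ((h.run ω).y_step s _ ((h.run ω).y_mem s))
    simp only [Pi.add_apply]
    rw [Real.norm_of_nonneg (by positivity)]
    calc ‖(z₀ ω).2 - (z (s + 1) ω).2‖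
        = ‖((z₀ ω).2 - (z s ω).2) - ((z (s + 1) ω).2 - (z s ω).2)‖ := by congr 1; abel
      _ ≤ _ := (norm_sub_le _ _).trans (by gcongr)

variable [CompleteSpace E] [CompleteSpace F] [IsProbabilityMeasure P] [IsProbabilityMeasure D]

/-- The expected noise of an epoch. -/
lemma integral_epochNoise_le (h : IsStochasticEpoch m P D Y ρ η B T Gx Gy z₀ z ζ) (hρ : 0 < ρ)
    (hη : 0 < η) (hT : T ≠ 0) {ℓ μy : ℝ} (hK : 0 ≤ noiseCoeff ℓ ρ μy) :
    Integrable (fun ω => epochNoise ℓ ρ μy η T (z₀ ω).1 (z₀ ω).2 (fun s => (z s ω).1)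
      (fun s => Gx (z s ω, ζ s ω)) (fun s => ∫ r, Gx (z s ω, r) ∂D) (fun s => (z s ω).2)
      (fun s => Gy (z s ω, ζ s ω)) (fun s => ∫ r, Gy (z s ω, r) ∂D)) P ∧
    ∫ ω, epochNoise ℓ ρ μy η T (z₀ ω).1 (z₀ ω).2 (fun s => (z s ω).1)
      (fun s => Gx (z s ω, ζ s ω)) (fun s => ∫ r, Gx (z s ω, r) ∂D) (fun s => (z s ω).2)
      (fun s => Gy (z s ω, ζ s ω)) (fun s => ∫ r, Gy (z s ω, r) ∂D) ∂P
      ≤ 9 * B ^ 2 * η + 5 * noiseCoeff ℓ ρ μy * B ^ 2 * η ^ 2 := by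
  obtain ⟨i1, e1⟩ := integral_sum_inner_dev h.queryX (fun s hs => h.measurable_fst_sub hs)
    (fun s hs => (h.memLp_fst_sub hρ hη s hs).1)
  obtain ⟨i2, e2⟩ := integral_sum_inner_dev h.queryY (fun s hs => h.measurable_snd_sub hs)
    (fun s hs => h.memLp_snd_sub hη s hs)
  obtain ⟨-, l3, e3⟩ := memLp_sum_dev h.mono h.sample_meas h.queryX T le_rfl
  obtain ⟨-, l4, e4⟩ := memLp_sum_dev h.mono h.sample_meas h.queryY T le_rfl
  have i3 := (integrable_sq_norm l3).const_mul (η / 2)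
  have i4 := (integrable_sq_norm l4).const_mul (η / 2)
  set K := noiseCoeff ℓ ρ μy with hKdef
  have hsq : ∀ s ∈ Finset.range T, Integrable (fun ω => sqNoise ℓ ρ μy η (z₀ ω).1 (z s ω).1
      (Gx (z s ω, ζ s ω)) (∫ r, Gx (z s ω, r) ∂D) (Gy (z s ω, ζ s ω))
      (∫ r, Gy (z s ω, r) ∂D)) P ∧
      ∫ ω, sqNoise ℓ ρ μy η (z₀ ω).1 (z s ω).1
      (Gx (z s ω, ζ s ω)) (∫ r, Gx (z s ω, r) ∂D) (Gy (z s ω, ζ s ω))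
      (∫ r, Gy (z s ω, r) ∂D) ∂P ≤ 9 / 2 * η * B ^ 2 + 5 * K * B ^ 2 * η ^ 2 := by
    intro s hs
    have hs := Finset.mem_range.1 hs
    obtain ⟨a1, b1⟩ := (h.queryX s hs).memLp_value
    obtain ⟨a2, b2⟩ := (h.queryY s hs).memLp_value
    obtain ⟨a3, b3⟩ := (h.queryX s hs).memLp_mean
    obtain ⟨a4, b4⟩ := (h.queryY s hs).memLp_mean
    obtain ⟨a5, b5⟩ := h.memLp_fst_sub hρ hη s hs
    replace a1 := integrable_sq_norm a1
    replace a2 := integrable_sq_norm a2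
    replace a3 := integrable_sq_norm a3
    replace a4 := integrable_sq_norm a4
    replace a5 := integrable_sq_norm a5
    have j1 := a1.add a2
    have j2 := j1.add a3
    have j3 := (j2.add a4).const_mul (η / 2)
    have k1 := (a1.const_mul 2).add (a5.const_mul (8 * ρ ^ 2))
    have k2 := (k1.add a2).const_mul (η / 2 + K * η ^ 2)
    refine ⟨j3.add k2, ?_⟩
    have e := integral_add j3 k2
    have e' : ∀ c : ℝ, ∀ φ : Ω → ℝ, ∫ ω, c * φ ω ∂P = c * ∫ ω, φ ω ∂P :=
      fun c φ => integral_const_mul c φ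
    rw [e', e', integral_add' (j2) a4, integral_add' j1 a3, integral_add' a1 a2,
      integral_add' k1 a2, integral_add' (a1.const_mul 2) (a5.const_mul (8 * ρ ^ 2)), e', e'] at e
    refine e.le.trans ?_
    have hc : 0 ≤ η / 2 + K * η ^ 2 := by positivity
    have t1 : η / 2 * (∫ ω, ‖Gx (z s ω, ζ s ω)‖ ^ 2 ∂P + ∫ ω, ‖Gy (z s ω, ζ s ω)‖ ^ 2 ∂P
        + ∫ ω, ‖∫ r, Gx (z s ω, r) ∂D‖ ^ 2 ∂P + ∫ ω, ‖∫ r, Gy (z s ω, r) ∂D‖ ^ 2 ∂P)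
        ≤ η / 2 * (4 * B ^ 2) := by gcongr; linarith
    have t2 : (η / 2 + K * η ^ 2) * (2 * ∫ ω, ‖Gx (z s ω, ζ s ω)‖ ^ 2 ∂P
        + 8 * ρ ^ 2 * ∫ ω, ‖(z s ω).1 - (z₀ ω).1‖ ^ 2 ∂P + ∫ ω, ‖Gy (z s ω, ζ s ω)‖ ^ 2 ∂P)
        ≤ (η / 2 + K * η ^ 2) * (5 * B ^ 2) := by gcongr; linarith
    linarith
  have i5 := integrable_finsetSum _ fun s hs => (hsq s hs).1
  have e5 : ∫ ω, ∑ s ∈ Finset.range T, sqNoise ℓ ρ μy η (z₀ ω).1 (z s ω).1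
      (Gx (z s ω, ζ s ω)) (∫ r, Gx (z s ω, r) ∂D) (Gy (z s ω, ζ s ω))
      (∫ r, Gy (z s ω, r) ∂D) ∂P ≤ T * (9 / 2 * η * B ^ 2 + 5 * K * B ^ 2 * η ^ 2) := by
    rw [integral_finsetSum _ fun s hs => (hsq s hs).1]
    refine (Finset.sum_le_sum fun s hs => (hsq s hs).2).trans_eq ?_
    rw [Finset.sum_const, Finset.card_range, nsmul_eq_mul]
  have j1 := i1.add i2
  have j2 := j1.add i3
  have j3 := j2.add i4
  have j4 := (j3.add i5).const_mul (1 / (T : ℝ))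
  refine ⟨j4, ?_⟩
  refine (integral_const_mul (1 / (T : ℝ)) _).le.trans ?_
  have e6 := integral_add' j3 i5
  rw [integral_add' j2 i4, integral_add' j1 i3, integral_add' i1 i2, e1, e2] at e6
  -- The two squared sums contribute `4ηB²` per step and the squared terms `9/2 ηB²`, together below
  -- `9ηB²`.
  refine (mul_le_mul_of_nonneg_left (e6.le.trans (?_ : _ ≤
    T * (9 * B ^ 2 * η + 5 * K * B ^ 2 * η ^ 2))) (by positivity)).trans_eq ?_
  · have e7 : ∫ ω, η / 2 * ‖∑ s ∈ Finset.range T, ((∫ r, Gx (z s ω, r) ∂D)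
        - Gx (z s ω, ζ s ω))‖ ^ 2 ∂P ≤ η / 2 * (T * (4 * B ^ 2)) := by
      rw [integral_const_mul]; gcongr
    have e8 : ∫ ω, η / 2 * ‖∑ s ∈ Finset.range T, ((∫ r, Gy (z s ω, r) ∂D)
        - Gy (z s ω, ζ s ω))‖ ^ 2 ∂P ≤ η / 2 * (T * (4 * B ^ 2)) := by
      rw [integral_const_mul]; gcongr
    have e9 : 0 ≤ (T : ℝ) * (η * B ^ 2) := by positivity
    linarith
  · rw [← mul_assoc, one_div_mul_cancel (by exact_mod_cast hT), one_mul]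

end IsStochasticEpoch

end StochasticEpoch

/-! ### The filtration generated by the samples, in lexicographic order. -/

section Past

variable {Ω Ξ : Type*} {mΩ : MeasurableSpace Ω} [mΞ : MeasurableSpace Ξ]

/-- The information in the samples used before step `t` of epoch `k`. -/
@[reducible]
def past (ξ : ℕ → ℕ → Ω → Ξ) (k t : ℕ) : MeasurableSpace Ω :=
  ⨆ p ∈ {p : ℕ × ℕ | p.1 < k ∨ (p.1 = k ∧ p.2 < t)}, MeasurableSpace.comap (ξ p.1 p.2) mΞ

variable {ξ : ℕ → ℕ → Ω → Ξ}

lemma past_mono {k t k' t' : ℕ} (h : k < k' ∨ (k = k' ∧ t ≤ t')) :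
    past ξ k t ≤ past ξ k' t' := by
  refine biSup_mono fun p hp => ?_
  simp only [Set.mem_ofPred_eq] at hp ⊢
  omega

lemma measurable_past_succ (k t : ℕ) : Measurable[past ξ k (t + 1)] (ξ k t) := by
  rw [measurable_iff_comap_le]
  exact le_biSup (fun p : ℕ × ℕ => MeasurableSpace.comap (ξ p.1 p.2) mΞ)
    (i := (k, t)) (by simp)

lemma freshSample_past {P : Measure Ω} {D : Measure Ξ}
    (hξ : ∀ k t, Measurable (ξ k t)) (hlaw : ∀ k t, Measure.map (ξ k t) P = D)
    (hind : iIndepFun (fun p : ℕ × ℕ => ξ p.1 p.2) P) (k t : ℕ) :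
    FreshSample (past ξ k t) P D (ξ k t) where
  le := iSup₂_le fun p _ => (hξ p.1 p.2).comap_le
  meas := hξ k t
  law := hlaw k t
  indep := by
    have h := indep_iSup_of_disjoint (fun p : ℕ × ℕ => (hξ p.1 p.2).comap_le) hind.iIndep
      (S := {p : ℕ × ℕ | p.1 < k ∨ (p.1 = k ∧ p.2 < t)}) (T := {(k, t)}) (by simp)
    simpa [past] using h

end Past

/-! ### Adaptedness of the iterates. -/

section Measurability

variable {Ω Ξ E F : Type*} {mΞ : MeasurableSpace Ξ}
  [NormedAddCommGroup E] [InnerProductSpace ℝ E] [MeasurableSpace E]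
  [BorelSpace E] [SecondCountableTopology E]
  [NormedAddCommGroup F] [InnerProductSpace ℝ F] [CompleteSpace F] [MeasurableSpace F]
  [BorelSpace F] [SecondCountableTopology F]

lemma measurable_sgdaIter {m : ℕ → MeasurableSpace Ω} (hm : Monotone m) {Y : Set F}
    (hne : Y.Nonempty) (hc : IsClosed Y) (hY : Convex ℝ Y) {ρ η : ℝ} (hρη : 0 ≤ ρ * η) {G : E × F → Ξ → E × F}
    (hG : Measurable (Function.uncurry G)) {z₀ : Ω → E × F} (hz₀ : Measurable[m 0] z₀)
    {ζ : ℕ → Ω → Ξ} (hζ : ∀ s, Measurable[m (s + 1)] (ζ s)) (t : ℕ) :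
    Measurable[m t] fun ω => sgdaIter Y (2 * ρ) η G (z₀ ω) (fun s => ζ s ω) t := by
  induction t with
  | zero => exact hz₀
  | succ t ih =>
    have h' : 0 ≤ 2 * ρ * η := by linarith
    have ih' := ih.mono (hm t.le_succ) le_rfl
    have hz' : Measurable[m (t + 1)] z₀ := hz₀.mono (hm (Nat.zero_le _)) le_rfl
    have hg : Measurable[m (t + 1)] fun ω =>
        G (sgdaIter Y (2 * ρ) η G (z₀ ω) (fun s => ζ s ω) t) (ζ t ω) :=
      hG.comp (ih'.prodMk (hζ t))
    have e : ∀ ω, sgdaIter Y (2 * ρ) η G (z₀ ω) (fun s => ζ s ω) (t + 1) =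
        explicitStep Y (2 * ρ) η (z₀ ω).1 (sgdaIter Y (2 * ρ) η G (z₀ ω) (fun s => ζ s ω) t)
          (G (sgdaIter Y (2 * ρ) η G (z₀ ω) (fun s => ζ s ω) t) (ζ t ω)) := fun ω => by
      rw [sgdaIter, sgdaStep_eq hne hc hY h']
    simp only [e, explicitStep]
    refine Measurable.prodMk ?_ ?_
    · exact Measurable.const_smul (((measurable_fst.comp ih').add
        ((measurable_fst.comp hz').const_smul _)).sub ((measurable_fst.comp hg).const_smul _)) _
    · exact (lipschitz_nearest hne hc hY).continuous.measurable.comp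
        ((measurable_snd.comp ih').add ((measurable_snd.comp hg).const_smul _))

lemma measurable_sgdaEpoch {m : ℕ → MeasurableSpace Ω} (hm : Monotone m) {Y : Set F}
    (hne : Y.Nonempty) (hc : IsClosed Y) (hY : Convex ℝ Y) {ρ η : ℝ} (hρη : 0 ≤ ρ * η) {G : E × F → Ξ → E × F}
    (hG : Measurable (Function.uncurry G)) {z₀ : Ω → E × F} (hz₀ : Measurable[m 0] z₀)
    {ζ : ℕ → Ω → Ξ} (hζ : ∀ s, Measurable[m (s + 1)] (ζ s)) (T : ℕ) :
    Measurable[m T] fun ω => sgdaEpoch Y (2 * ρ) η T G (z₀ ω) (fun s => ζ s ω) := by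
  simp only [sgdaEpoch]
  have hsum : Measurable[m T] fun ω => ∑ s ∈ Finset.range T,
      sgdaIter Y (2 * ρ) η G (z₀ ω) (fun s => ζ s ω) (s + 1) :=
    Finset.measurable_sum _ fun s hs =>
      (measurable_sgdaIter hm hne hc hY hρη hG hz₀ hζ (s + 1)).mono
        (hm (Finset.mem_range.1 hs)) le_rfl
  exact hsum.const_smul (1 / (T : ℝ))

lemma measurable_pesSGDA {ξ : ℕ → ℕ → Ω → Ξ} {Y : Set F} (hc : IsClosed Y) (hY : Convex ℝ Y)
    {ρ : ℝ} {η : ℕ → ℝ} {T : ℕ → ℕ} (hρη : ∀ k, 0 ≤ ρ * η k) (hT : ∀ k, T k ≠ 0)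
    {G : E × F → Ξ → E × F} (hG : Measurable (Function.uncurry G)) {z₀ : E × F} (hz₀ : z₀.2 ∈ Y)
    (k : ℕ) :
    (Measurable[past ξ k 0] fun ω => pesSGDA Y (2 * ρ) η T G z₀ (fun i j => ξ i j ω) k) ∧
      ∀ ω, (pesSGDA Y (2 * ρ) η T G z₀ (fun i j => ξ i j ω) k).2 ∈ Y := by
  induction k with
  | zero => exact ⟨measurable_const, fun _ => hz₀⟩
  | succ k ih =>
    refine ⟨?_, fun ω => sgdaEpoch_mem hc hY (hρη k) G (ih.2 ω) _ (hT k)⟩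
    refine (measurable_sgdaEpoch (m := past ξ k) (fun a b hab => past_mono (Or.inr ⟨rfl, hab⟩))
      ⟨_, hz₀⟩ hc hY (hρη k) hG ih.1 (measurable_past_succ k) (T k)).mono
      (past_mono (Or.inl k.lt_succ_self)) le_rfl

end Measurability

/-! ### Measurability of the duality gap and bound of the initial potential. -/

section Gap

variable {E F : Type*} [NormedAddCommGroup E] [InnerProductSpace ℝ E] [CompleteSpace E]
  [NormedAddCommGroup F] [InnerProductSpace ℝ F] [CompleteSpace F]
  {ℓ L ρ μ μx μy : ℝ} {f : E → F → ℝ} {Y : Set F}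

/-- Replaces an uncountable infimum by a countable one, so that the dual function becomes measurable
along the run. -/
lemma RegularObjective.iInf_denseSeq [TopologicalSpace.SeparableSpace E] (h : RegularObjective ℓ L ρ μ μx μy f Y)
    {y : F} (hy : y ∈ Y) :
    (⨅ x, f x y) = ⨅ n : ℕ, f (TopologicalSpace.denseSeq E n) y := by
  obtain ⟨xs, hxs, hmin, -⟩ := h.exists_dual hy
  rw [hxs]
  refine le_antisymm (le_ciInf fun n => hmin _) ?_
  refine (TopologicalSpace.denseRange_denseSeq E).induction_on
    (p := fun x => (⨅ n : ℕ, f (TopologicalSpace.denseSeq E n) y) ≤ f x y) xs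
    (isClosed_le continuous_const (h.continuous_left hy)) fun n => ?_
  exact ciInf_le ⟨f xs y, by rintro _ ⟨n, rfl⟩; exact hmin _⟩ n

lemma RegularObjective.measurable_dualityGap [MeasurableSpace E] [BorelSpace E]
    [TopologicalSpace.SeparableSpace E] [MeasurableSpace F] [BorelSpace F]
    (h : RegularObjective ℓ L ρ μ μx μy f Y) {Ω : Type*} [MeasurableSpace Ω] {z : Ω → E × F}
    (hz : Measurable z) (hzY : ∀ ω, (z ω).2 ∈ Y) :
    Measurable fun ω => dualityGap f Y (z ω).1 (z ω).2 := by
  refine Measurable.sub (h.smooth.1.continuous.measurable.comp (measurable_fst.comp hz)) ?_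
  have e : (fun ω => ⨅ x, f x (z ω).2) =
      fun ω => ⨅ n : ℕ, f (TopologicalSpace.denseSeq E n) (z ω).2 :=
    funext fun ω => h.iInf_denseSeq (hzY ω)
  rw [e]
  refine Measurable.iInf fun n => ?_
  exact (continuousOn_iff_continuous_domRestrict.1 (h.continuousOn_right _)).measurable.comp
    ((measurable_snd.comp hz).subtype_mk (h := hzY))

lemma RegularObjective.regGap_le_potential [FiniteDimensional ℝ E]
    (h : RegularObjective ℓ L ρ μ μx μy f Y) (z : E × F) :
    regGap f Y ρ z.1 z.1 z.2 ≤ potential f Y L ρ μ z := by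
  have hρ := h.ρ_pos
  have hμ := h.μ_pos
  have hL := h.L_nonneg
  have hV := sub_nonneg.2 (h.primalMin_le z.1)
  rw [potential]
  have : 0 ≤ (8 + 8 * ρ * (3 / (L + 2 * ρ)) + 2 * μ * (3 / (L + 2 * ρ))) *
    (primal f Y z.1 - primalMin f Y) := by positivity
  linarith

/-- The potential is bounded by the squared gradients. -/
lemma RegularObjective.potential_le_grad [FiniteDimensional ℝ E]
    (h : RegularObjective ℓ L ρ μ μx μy f Y) {x : E} {y : F} (hy : y ∈ Y) :
    potential f Y L ρ μ (x, y) ≤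
      27 * (‖gradX f x y‖ ^ 2 / (2 * μx) + ‖gradY f x y‖ ^ 2 / (2 * μy)) := by
  have hρ := h.ρ_pos
  have hμ := h.μ_pos
  have hL := h.L_nonneg
  have hμx := h.μx_pos
  obtain ⟨xs, -, hmin, hpl⟩ := h.exists_dual hy
  obtain ⟨xh, hxh, -, -⟩ := h.exists_prox hy x
  obtain ⟨xp, hxp, -⟩ := h.pl
  have h1 := h.primal_le hy x
  have h2 : f x y - f xs y ≤ ‖gradX f x y‖ ^ 2 / (2 * μx) := by
    rw [le_div_iff₀ (by positivity)]; linarith [hpl x]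
  have h3 : f xs y ≤ primalMin f Y := by
    have : primalMin f Y = primal f Y xp := le_antisymm (h.primalMin_le xp) (le_ciInf hxp)
    rw [this]
    exact (hmin xp).trans (h.le_primal hy xp)
  have h4 : f xs y ≤ regDual f ρ x y := by
    rw [hxh]
    have : 0 ≤ ρ * ‖xh - x‖ ^ 2 := by positivity
    linarith [hmin xh]
  have hV := sub_nonneg.2 (h.primalMin_le x)
  -- Both `P(x) - min P` and the regularized gap are at most `P(x) - min f(·, y)`. The weight 26 of
  -- the former and 1 of the latter give 27.
  have c1 : 8 + 8 * ρ * (3 / (L + 2 * ρ)) + 2 * μ * (3 / (L + 2 * ρ)) ≤ 26 := by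
    have : 8 + 8 * ρ * (3 / (L + 2 * ρ)) + 2 * μ * (3 / (L + 2 * ρ)) =
      8 + (24 * ρ + 6 * μ) / (L + 2 * ρ) := by field_simp; ring
    rw [this]
    have : (24 * ρ + 6 * μ) / (L + 2 * ρ) ≤ 18 := by
      rw [div_le_iff₀ (by positivity)]; linarith [h.μ_le]
    linarith
  have h5 := mul_le_mul_of_nonneg_right c1 hV
  rw [potential, regGap]
  simp only [sub_self, norm_zero]
  linarith

end Gap

/-! ### The recursion over epochs in expectation. -/

section Outer

variable {Ω Ξ E F : Type*} {mΩ : MeasurableSpace Ω} {mΞ : MeasurableSpace Ξ}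
  [NormedAddCommGroup E] [InnerProductSpace ℝ E] [CompleteSpace E] [FiniteDimensional ℝ E]
  [MeasurableSpace E] [BorelSpace E] [SecondCountableTopology E]
  [NormedAddCommGroup F] [InnerProductSpace ℝ F] [CompleteSpace F] [FiniteDimensional ℝ F]
  [MeasurableSpace F] [BorelSpace F] [SecondCountableTopology F]
  {P : Measure Ω} {D : Measure Ξ} [IsProbabilityMeasure P] [IsProbabilityMeasure D]
  {ℓ L ρ μ μx μy B : ℝ} {f : E → F → ℝ} {Y : Set F}
  {Gx : E → F → Ξ → E} {Gy : E → F → Ξ → F} {ξ : ℕ → ℕ → Ω → Ξ} {η : ℕ → ℝ} {T : ℕ → ℕ}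

/-- The oracle and the samples. -/
structure IsOracle (P : Measure Ω) (D : Measure Ξ) (f : E → F → ℝ) (Y : Set F)
    (Gx : E → F → Ξ → E) (Gy : E → F → Ξ → F) (ξ : ℕ → ℕ → Ω → Ξ) : Prop where
  measX : Measurable (fun p : (E × F) × Ξ => Gx p.1.1 p.1.2 p.2)
  measY : Measurable (fun p : (E × F) × Ξ => Gy p.1.1 p.1.2 p.2)
  unbiasedX : ∀ x, ∀ y ∈ Y, Integrable (Gx x y) D ∧ ∫ s, Gx x y s ∂D = gradX f x y
  unbiasedY : ∀ x, ∀ y ∈ Y, Integrable (Gy x y) D ∧ ∫ s, Gy x y s ∂D = gradY f x y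
  meas : ∀ k t, Measurable (ξ k t)
  law : ∀ k t, Measure.map (ξ k t) P = D
  indep : iIndepFun (fun p : ℕ × ℕ => ξ p.1 p.2) P

/-- Second moment bound for the stochastic gradients used in a run. -/
def SecondMomentBound (P : Measure Ω) (ρ B : ℝ) (Y : Set F) (Gx : E → F → Ξ → E)
    (Gy : E → F → Ξ → F) (ξ : ℕ → ℕ → Ω → Ξ) (η : ℕ → ℝ) (T : ℕ → ℕ) (z₀ : E × F) : Prop :=
  ∀ k t, t < T k →
    let z : Ω → E × F := fun ω => pesInner Y (2 * ρ) η T (fun z s => (Gx z.1 z.2 s, Gy z.1 z.2 s))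
      z₀ (fun i j => ξ i j ω) k t
    ∫⁻ ω, ‖Gx (z ω).1 (z ω).2 (ξ k t ω)‖ₑ ^ 2 ∂P ≤ ENNReal.ofReal (B ^ 2) ∧
      ∫⁻ ω, ‖Gy (z ω).1 (z ω).2 (ξ k t ω)‖ₑ ^ 2 ∂P ≤ ENNReal.ofReal (B ^ 2)

omit [FiniteDimensional ℝ E] [FiniteDimensional ℝ F] [IsProbabilityMeasure P]
  [IsProbabilityMeasure D] in
lemma IsOracle.isStochasticEpoch (o : IsOracle P D f Y Gx Gy ξ) (hc : IsClosed Y)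
    (hY : Convex ℝ Y) (hρ : 0 ≤ ρ) (hη : ∀ k, 0 ≤ η k) (hT : ∀ k, T k ≠ 0) {z₀ : E × F}
    (hz₀ : z₀.2 ∈ Y) (hB : SecondMomentBound P ρ B Y Gx Gy ξ η T z₀) (k : ℕ) :
    IsStochasticEpoch (past ξ k) P D Y ρ (η k) B (T k) (fun p => Gx p.1.1 p.1.2 p.2)
      (fun p => Gy p.1.1 p.1.2 p.2)
      (fun ω => pesSGDA Y (2 * ρ) η T (fun z s => (Gx z.1 z.2 s, Gy z.1 z.2 s)) z₀
        (fun i j => ξ i j ω) k)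
      (fun t ω => pesInner Y (2 * ρ) η T (fun z s => (Gx z.1 z.2 s, Gy z.1 z.2 s)) z₀
        (fun i j => ξ i j ω) k t) (ξ k) := by
  have hG : Measurable (Function.uncurry fun (z : E × F) s => (Gx z.1 z.2 s, Gy z.1 z.2 s)) :=
    o.measX.prodMk o.measY
  have hρη : ∀ k, 0 ≤ ρ * η k := fun k => mul_nonneg hρ (hη k)
  obtain ⟨h1, h2⟩ := measurable_pesSGDA (ξ := ξ) hc hY hρη hT hG hz₀ k
  have hmono : Monotone (past ξ k) := fun a b hab => past_mono (Or.inr ⟨rfl, hab⟩)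
  have hrun := fun ω => isEpochRun_sgdaIter hc hY (hρη k)
    (fun (z : E × F) s => (Gx z.1 z.2 s, Gy z.1 z.2 s)) (h2 ω) (fun s => ξ k s ω)
  have hm := measurable_sgdaIter hmono ⟨_, hz₀⟩ hc hY (hρη k) hG h1 (measurable_past_succ k)
  have hX : ∀ z : E × F, z.2 ∈ Y → Integrable (Gx z.1 z.2) D :=
    fun z hz => (o.unbiasedX z.1 z.2 hz).1
  have hY' : ∀ z : E × F, z.2 ∈ Y → Integrable (Gy z.1 z.2) D :=
    fun z hz => (o.unbiasedY z.1 z.2 hz).1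
  refine ⟨hmono, measurable_past_succ k, h1, fun s hs => ?_, fun s hs => ?_, hrun⟩
  · exact ⟨freshSample_past o.meas o.law o.indep k s, o.measX, hm s,
      fun ω => hX _ ((hrun ω).y_mem s), (hB k s hs).1⟩
  · exact ⟨freshSample_past o.meas o.law o.indep k s, o.measY, hm s,
      fun ω => hY' _ ((hrun ω).y_mem s), (hB k s hs).2⟩

/-- One epoch contracts the potential up to a noise with small mean. -/
lemma RegularObjective.exists_noise (h : RegularObjective ℓ L ρ μ μx μy f Y)
    (o : IsOracle P D f Y Gx Gy ξ) (hη : ∀ k, 0 < η k) (hη1 : ∀ k, ρ * η k ≤ 1)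
    (hT : ∀ k, 424 ≤ η k * T k * min ρ μy) {z₀ : E × F}
    (hz₀ : z₀.2 ∈ Y) (hB : SecondMomentBound P ρ B Y Gx Gy ξ η T z₀) (k : ℕ) :
    ∃ W : Ω → ℝ, Integrable W P ∧
      ∫ ω, W ω ∂P ≤ 9 * B ^ 2 * η k + 5 * noiseCoeff ℓ ρ μy * B ^ 2 * η k ^ 2 ∧
      ∀ ω, potential f Y L ρ μ (pesSGDA Y (2 * ρ) η T
          (fun z s => (Gx z.1 z.2 s, Gy z.1 z.2 s)) z₀ (fun i j => ξ i j ω) (k + 1)) ≤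
        (1 - rate L ρ μ) * potential f Y L ρ μ (pesSGDA Y (2 * ρ) η T
          (fun z s => (Gx z.1 z.2 s, Gy z.1 z.2 s)) z₀ (fun i j => ξ i j ω) k)
          + 46 / 105 * (106 * W ω) := by
  have hρ := h.ρ_pos
  have hT0 : ∀ k, T k ≠ 0 := fun k h0 => by
    have := hT k
    rw [h0] at this
    norm_num at this
  have hep := o.isStochasticEpoch h.closed h.convex hρ.le (fun k => (hη k).le) hT0 hz₀ hB k
  have hK : 0 ≤ noiseCoeff ℓ ρ μy := by
    have := hρ.le.trans h.ρ_le
    have := h.μy_pos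
    rw [noiseCoeff]; positivity
  obtain ⟨i1, i2⟩ := hep.integral_epochNoise_le hρ (hη k) (hT0 k) hK
  refine ⟨_, i1, i2, fun ω => ?_⟩
  have hG : Measurable (Function.uncurry fun (z : E × F) s => (Gx z.1 z.2 s, Gy z.1 z.2 s)) :=
    o.measX.prodMk o.measY
  have hmem := fun k => (measurable_pesSGDA (ξ := ξ) h.closed h.convex
    (fun k => mul_nonneg hρ.le (hη k).le) hT0 hG hz₀ k).2 ω
  have hrun := hep.run ω
  refine h.potential_le (hmem k) (hmem (k + 1)) _ _ _ ?_
  have hx : (fun s => ∫ r, Gx (pesInner Y (2 * ρ) η T (fun z s => (Gx z.1 z.2 s, Gy z.1 z.2 s)) z₀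
        (fun i j => ξ i j ω) k s).1 (pesInner Y (2 * ρ) η T
        (fun z s => (Gx z.1 z.2 s, Gy z.1 z.2 s)) z₀ (fun i j => ξ i j ω) k s).2 r ∂D) =
      fun s => gradX f _ _ := funext fun s => (o.unbiasedX _ _ (hrun.y_mem s)).2
  have hy : (fun s => ∫ r, Gy (pesInner Y (2 * ρ) η T (fun z s => (Gx z.1 z.2 s, Gy z.1 z.2 s)) z₀
        (fun i j => ξ i j ω) k s).1 (pesInner Y (2 * ρ) η T
        (fun z s => (Gx z.1 z.2 s, Gy z.1 z.2 s)) z₀ (fun i j => ξ i j ω) k s).2 r ∂D) =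
      fun s => gradY f _ _ := funext fun s => (o.unbiasedY _ _ (hrun.y_mem s)).2
  simp only [hx, hy]
  refine h.epoch_le (hη k) (hη1 k) hrun (hT k) (hmem (k + 1)) ?_ ?_
  · exact (Prod.smul_fst _ _).trans (congrArg _ Prod.fst_sum)
  · exact (Prod.smul_snd _ _).trans (congrArg _ Prod.snd_sum)

/-- The expected duality gap after `K` epochs. -/
theorem RegularObjective.integral_dualityGap_le (h : RegularObjective ℓ L ρ μ μx μy f Y)
    (o : IsOracle P D f Y Gx Gy ξ) (hη : ∀ k, 0 < η k) (hη1 : ∀ k, ρ * η k ≤ 1)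
    (hT : ∀ k, 424 ≤ η k * T k * min ρ μy) {z₀ : E × F}
    (hz₀ : z₀.2 ∈ Y) (hB : SecondMomentBound P ρ B Y Gx Gy ξ η T z₀) (K : ℕ) :
    let z : Ω → E × F := fun ω => pesSGDA Y (2 * ρ) η T
          (fun z s => (Gx z.1 z.2 s, Gy z.1 z.2 s)) z₀ (fun i j => ξ i j ω) K
    Integrable (fun ω => dualityGap f Y (z ω).1 (z ω).2) P ∧
      ∫ ω, dualityGap f Y (z ω).1 (z ω).2 ∂P ≤ 4 * (ρ / μx + 1) *
        ((1 - rate L ρ μ) ^ K * (27 * (B ^ 2 / (2 * μx) + B ^ 2 / (2 * μy)))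
        + ∑ j ∈ Finset.range K, (1 - rate L ρ μ) ^ (K - 1 - j) *
          (47 * (9 * B ^ 2 * η j + 5 * noiseCoeff ℓ ρ μy * B ^ 2 * η j ^ 2))) := by
  intro z
  have hρ := h.ρ_pos
  have hμ := h.μ_pos
  have hμx := h.μx_pos
  have hμy := h.μy_pos
  have hL := h.L_nonneg
  have hT0 : ∀ k, T k ≠ 0 := fun k h0 => by
    have := hT k
    rw [h0] at this
    norm_num at this
  have hG : Measurable (Function.uncurry fun (z : E × F) s => (Gx z.1 z.2 s, Gy z.1 z.2 s)) :=
    o.measX.prodMk o.measY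
  have hc : 0 < cConst L ρ := by rw [cConst]; positivity
  have hq0 : 0 ≤ 1 - rate L ρ μ := by
    rw [one_sub_rate L ρ μ (by positivity)]; positivity
  set q := 1 - rate L ρ μ with hq
  -- The noise is chosen pathwise for each epoch, so the recursion can be unrolled before taking
  -- expectations; the potential itself need not be measurable.
  choose W hW1 hW2 hW3 using h.exists_noise o hη hη1 hT hz₀ hB
  have hep := o.isStochasticEpoch h.closed h.convex hρ.le (fun k => (hη k).le) hT0 hz₀ hB 0
  -- The first query is at the deterministic point `z₀`, and there is one because `T 0 ≠ 0`; the
  -- moment bound on the run therefore bounds the exact gradient there.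
  have hgx : ‖gradX f z₀.1 z₀.2‖ ^ 2 ≤ B ^ 2 := by
    have h1 := (hep.queryX 0 (Nat.pos_of_ne_zero (hT0 0))).memLp_mean.2
    simp only [pesInner, sgdaIter, pesSGDA, (o.unbiasedX _ _ hz₀).2] at h1
    simpa using h1
  have hgy : ‖gradY f z₀.1 z₀.2‖ ^ 2 ≤ B ^ 2 := by
    have h1 := (hep.queryY 0 (Nat.pos_of_ne_zero (hT0 0))).memLp_mean.2
    simp only [pesInner, sgdaIter, pesSGDA, (o.unbiasedY _ _ hz₀).2] at h1
    simpa using h1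
  have hpot0 : potential f Y L ρ μ z₀ ≤ 27 * (B ^ 2 / (2 * μx) + B ^ 2 / (2 * μy)) := by
    refine (h.potential_le_grad (x := z₀.1) hz₀).trans ?_
    gcongr
  have hrec : ∀ ω, ∀ n, potential f Y L ρ μ (pesSGDA Y (2 * ρ) η T
          (fun z s => (Gx z.1 z.2 s, Gy z.1 z.2 s)) z₀ (fun i j => ξ i j ω) n) ≤
        q ^ n * (27 * (B ^ 2 / (2 * μx) + B ^ 2 / (2 * μy)))
        + ∑ j ∈ Finset.range n, q ^ (n - 1 - j) * (46 / 105 * (106 * W j ω)) := by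
    intro ω n
    induction n with
    | zero => simpa [pesSGDA] using hpot0
    | succ n ih =>
      refine (hW3 n ω).trans ?_
      have h1 := mul_le_mul_of_nonneg_left ih hq0
      have h2 : q * ∑ j ∈ Finset.range n, q ^ (n - 1 - j) * (46 / 105 * (106 * W j ω)) =
          ∑ j ∈ Finset.range n, q ^ (n + 1 - 1 - j) * (46 / 105 * (106 * W j ω)) := by
        rw [Finset.mul_sum]
        refine Finset.sum_congr rfl fun j hj => ?_
        have := Finset.mem_range.1 hj
        rw [← mul_assoc, ← pow_succ', show n - 1 - j + 1 = n + 1 - 1 - j by omega]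
      rw [Finset.sum_range_succ, ← h2, pow_succ']
      simp only [Nat.add_sub_cancel, Nat.sub_self, pow_zero, one_mul]
      linarith
  have hmem := measurable_pesSGDA (ξ := ξ) h.closed h.convex
    (fun k => mul_nonneg hρ.le (hη k).le) hT0 hG hz₀ K
  have hzm : Measurable z := hmem.1.mono (freshSample_past o.meas o.law o.indep K 0).le le_rfl
  have hgm := h.measurable_dualityGap hzm hmem.2
  have hWi : Integrable (fun ω => ∑ j ∈ Finset.range K, q ^ (K - 1 - j)
      * (46 / 105 * (106 * W j ω))) P :=
    integrable_finsetSum _ fun j _ => (((hW1 j).const_mul 106).const_mul _).const_mul _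
  have hbi : Integrable (fun ω => 4 * (ρ / μx + 1) *
        (q ^ K * (27 * (B ^ 2 / (2 * μx) + B ^ 2 / (2 * μy)))
        + ∑ j ∈ Finset.range K, q ^ (K - 1 - j) * (46 / 105 * (106 * W j ω)))) P :=
    ((integrable_const _).add hWi).const_mul _
  have hle : ∀ ω, dualityGap f Y (z ω).1 (z ω).2 ≤ 4 * (ρ / μx + 1) *
        (q ^ K * (27 * (B ^ 2 / (2 * μx) + B ^ 2 / (2 * μy)))
        + ∑ j ∈ Finset.range K, q ^ (K - 1 - j) * (46 / 105 * (106 * W j ω))) := fun ω => by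
    refine (h.dualityGap_le (hmem.2 ω) _).2.trans ?_
    gcongr
    exact (h.regGap_le_potential _).trans (hrec ω K)
  have hgi : Integrable (fun ω => dualityGap f Y (z ω).1 (z ω).2) P := by
    refine hbi.mono hgm.aestronglyMeasurable (Filter.Eventually.of_forall fun ω => ?_)
    have h0 := (h.dualityGap_le (hmem.2 ω) (z ω).1).1
    rw [Real.norm_of_nonneg h0]
    exact (hle ω).trans (le_abs_self _)
  refine ⟨hgi, (integral_mono hgi hbi hle).trans ?_⟩
  rw [integral_const_mul, integral_add (integrable_const _) hWi, integral_const,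
    integral_finsetSum _ fun j _ => (((hW1 j).const_mul 106).const_mul _).const_mul _]
  simp only [probReal_univ, one_smul, integral_const_mul]
  refine mul_le_mul_of_nonneg_left (add_le_add le_rfl (Finset.sum_le_sum fun j _ =>
    mul_le_mul_of_nonneg_left ?_ (pow_nonneg hq0 _))) (by positivity)
  have h1 := hW2 j
  have hK : 0 ≤ noiseCoeff ℓ ρ μy := by
    have := hρ.le.trans h.ρ_le
    rw [noiseCoeff]; positivity
  have h2 : 0 ≤ 9 * B ^ 2 * η j + 5 * noiseCoeff ℓ ρ μy * B ^ 2 * η j ^ 2 := by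
    have := hη j
    positivity
  linarith

end Outer

/-! ### Step sizes, epoch lengths and the choice of the number of epochs. -/

section Schedule

variable {L ρ μ : ℝ}

lemma rate_pos (hL : 0 ≤ L) (hρ : 0 < ρ) (hμ : 0 < μ) : 0 < rate L ρ μ := by
  rw [rate, cConst]; positivity

lemma rate_le_one (hL : 0 ≤ L) (hρ : 0 < ρ) (hμ : 0 < μ) : rate L ρ μ ≤ 1 := by
  rw [rate, cConst, div_le_one (by positivity)]
  have : 0 ≤ 4 * ρ + 248 / 53 * (L + 2 * ρ) := by positivity
  linarith

lemma one_div_rate_le (hL : 0 ≤ L) (hρ : 0 < ρ) (hμ : 0 < μ) (hμL : μ ≤ L + 2 * ρ) :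
    1 / rate L ρ μ ≤ 9 * ((L + ρ) / μ) := by
  rw [rate, cConst, one_div_div, ← mul_div_assoc, div_le_div_iff₀ (by positivity) hμ]
  nlinarith

lemma stepSize_pos {η₀ : ℝ} (hη₀ : 0 < η₀) (k : ℕ) : 0 < stepSize L ρ μ η₀ k := by
  rw [stepSize]; positivity

lemma stepSize_le {η₀ : ℝ} (hη₀ : 0 < η₀) (hα : 0 < rate L ρ μ) (k : ℕ) :
    stepSize L ρ μ η₀ k ≤ η₀ := by
  rw [stepSize]
  refine mul_le_of_le_one_right hη₀.le (Real.exp_le_one_iff.2 ?_)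
  have : 0 ≤ k * rate L ρ μ := by positivity
  linarith

lemma le_stepSize_mul_epochLength {η₀ μy : ℝ} (hη₀ : 0 < η₀) (hm : 0 < min ρ μy) (k : ℕ) :
    424 ≤ stepSize L ρ μ η₀ k * epochLength L ρ μ μy η₀ k * min ρ μy := by
  have h := Nat.le_ceil (212 * 2 / (η₀ * min ρ μy) * Real.exp (k * rate L ρ μ))
  have h1 := stepSize_pos (L := L) (ρ := ρ) (μ := μ) hη₀ k
  calc (424 : ℝ) = stepSize L ρ μ η₀ k * (212 * 2 / (η₀ * min ρ μy)
        * Real.exp (k * rate L ρ μ)) * min ρ μy := by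
        rw [stepSize, Real.exp_neg]; field_simp; norm_num
    _ ≤ _ := by rw [epochLength]; gcongr

lemma sum_exp_le {α : ℝ} (hα : 0 < α) (K : ℕ) :
    ∑ k ∈ Finset.range K, Real.exp (k * α) ≤ Real.exp (K * α) / α := by
  induction K with
  | zero => simp only [Finset.range_zero, Finset.sum_empty]; positivity
  | succ K ih =>
    rw [Finset.sum_range_succ, Nat.cast_succ, add_mul, one_mul, Real.exp_add]
    have h1 : Real.exp (K * α) * (1 + α) ≤ Real.exp (K * α) * Real.exp α := by
      gcongr; linarith [Real.add_one_le_exp α]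
    calc _ ≤ Real.exp (K * α) / α + Real.exp (K * α) := by linarith
      _ = Real.exp (K * α) * (1 + α) / α := by field_simp
      _ ≤ _ := by gcongr

lemma sum_epochLength_le {η₀ μy : ℝ} (hη₀ : 0 < η₀) (hm : 0 < min ρ μy) (hα : 0 < rate L ρ μ)
    (K : ℕ) : ((∑ k ∈ Finset.range K, epochLength L ρ μ μy η₀ k : ℕ) : ℝ) ≤
      424 / (η₀ * min ρ μy) * (Real.exp (K * rate L ρ μ) / rate L ρ μ) + K := by
  have h1 : ∀ k ∈ Finset.range K, (epochLength L ρ μ μy η₀ k : ℝ) ≤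
      424 / (η₀ * min ρ μy) * Real.exp (k * rate L ρ μ) + 1 := fun k _ => by
    have := Nat.ceil_lt_add_one (a := 212 * 2 / (η₀ * min ρ μy) * Real.exp (k * rate L ρ μ))
      (by positivity)
    rw [epochLength]
    refine this.le.trans_eq ?_
    norm_num
  push_cast
  refine (Finset.sum_le_sum h1).trans ?_
  rw [Finset.sum_add_distrib, ← Finset.mul_sum]
  have h2 := sum_exp_le hα K
  simp only [Finset.sum_const, Finset.card_range, nsmul_eq_mul, mul_one]
  gcongr

lemma exp_one_le_three {α : ℝ} (h : α ≤ 1) : Real.exp α ≤ 3 :=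
  (Real.exp_le_exp.2 h).trans (Real.exp_one_lt_d9.le.trans (by norm_num))

/-- Accumulated noise of a geometric recursion driven by geometrically decaying step sizes. -/
lemma noise_sum_le {α η₀ b k : ℝ} (hα : 0 < α) (hα1 : α ≤ 1) (hη₀ : 0 < η₀) (hb : 0 ≤ b)
    (hk : 0 ≤ k) (K : ℕ) :
    ∑ j ∈ Finset.range K, (1 - α) ^ (K - 1 - j) *
        (47 * (9 * b * (η₀ * Real.exp (-(j * α))) + 5 * k * b * (η₀ * Real.exp (-(j * α))) ^ 2)) ≤
      Real.exp (-(K * α)) *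
        (1269 * (b * η₀) * K + 705 * k * b * η₀ ^ 2 * (1 / (1 - Real.exp (-α)))) := by
  have hr : Real.exp (-α) < 1 := by rw [Real.exp_lt_one_iff]; linarith
  -- Contraction after epoch `j` and the decay of `η_j` multiply to `exp(-Kα)` up to the factor `exp
  -- α ≤ 3`, independently of `j`. First-order noise thus sums to a multiple of `K`, while the
  -- `η_j²` part keeps a summable factor.
  have hterm : ∀ j ∈ Finset.range K, (1 - α) ^ (K - 1 - j) *
        (47 * (9 * b * (η₀ * Real.exp (-(j * α))) + 5 * k * b * (η₀ * Real.exp (-(j * α))) ^ 2)) ≤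
      Real.exp (-(K * α)) * (1269 * (b * η₀)
        + 705 * k * b * η₀ ^ 2 * Real.exp (-α) ^ j) := by
    intro j hj
    have hj := Finset.mem_range.1 hj
    have h1 : (1 - α) ^ (K - 1 - j) ≤ 3 * Real.exp (-(K * α)) * Real.exp (j * α) := by
      calc (1 - α) ^ (K - 1 - j) ≤ Real.exp (-α) ^ (K - 1 - j) := by
            refine pow_le_pow_left₀ (by linarith) ?_ _
            linarith [Real.add_one_le_exp (-α)]
        _ = Real.exp α * Real.exp (-(K * α)) * Real.exp (j * α) := by
            rw [← Real.exp_nat_mul, ← Real.exp_add, ← Real.exp_add, Nat.sub_sub,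
              Nat.cast_sub (by omega)]
            congr 1; push_cast; ring
        _ ≤ _ := by gcongr; exact exp_one_le_three hα1
    have h2 : Real.exp (j * α) * Real.exp (-(j * α)) = 1 := by rw [← Real.exp_add]; simp
    have h3 : Real.exp (-α) ^ j = Real.exp (-(j * α)) := by
      rw [← Real.exp_nat_mul]; congr 1; ring
    rw [h3]
    refine (mul_le_mul_of_nonneg_right h1 (by positivity)).trans_eq ?_
    linear_combination (1269 * Real.exp (-(K * α)) * b * η₀
      + 705 * k * b * η₀ ^ 2 * Real.exp (-(K * α)) * Real.exp (-(j * α))) * h2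
  refine (Finset.sum_le_sum hterm).trans ?_
  rw [← Finset.mul_sum, Finset.sum_add_distrib,
    ← Finset.mul_sum (f := fun j => Real.exp (-α) ^ j)]
  have hgeo : ∑ j ∈ Finset.range K, Real.exp (-α) ^ j ≤ 1 / (1 - Real.exp (-α)) := by
    rw [one_div, ← tsum_geometric_of_lt_one (Real.exp_pos _).le hr]
    exact (summable_geometric_of_lt_one (Real.exp_pos _).le hr).sum_le_tsum _
      fun _ _ => by positivity
  rw [Finset.sum_const, Finset.card_range, nsmul_eq_mul, mul_comm (K : ℝ) (1269 * (b * η₀))]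
  gcongr

/-- Choice of the number of epochs. -/
lemma exists_epochs {α M : ℝ} (hα : 0 < α) (hα1 : α ≤ 1) (hM : 0 < M) (N : ℝ) :
    ∃ εbar : ℝ, 0 < εbar ∧ ∀ ε : ℝ, 0 < ε → ε < εbar → ∃ K : ℕ,
      N ≤ K ∧ 1 ≤ Real.log (1 / ε) ∧ (K : ℝ) ≤ 4 * Real.log (1 / ε) / α ∧
      M * K * Real.exp (-(K * α)) ≤ ε ∧
      Real.exp (K * α) ≤ 12 * M * Real.log (1 / ε) / (α * ε) := by
  set A := 4 * M / α with hA
  have hApos : 0 < A := by positivity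
  -- The threshold ensures `log(1/ε) ≥ 1`, `log A ≤ log(1/ε)` and `N ≤ l`, hence `N ≤ K` since `α ≤
  -- 1`.
  set Λ := max 1 (max (Real.log A) (max N 0 - Real.log A)) with hΛ
  refine ⟨Real.exp (-Λ), Real.exp_pos _, fun ε hε hlt => ?_⟩
  set lam := Real.log (1 / ε) with hlam
  have hlamΛ : Λ ≤ lam := by
    have := (Real.log_lt_iff_lt_exp hε).2 hlt
    rw [hlam, one_div, Real.log_inv]; linarith
  have h1 : 1 ≤ lam := (le_max_left _ _).trans hlamΛ
  have h2 : Real.log A ≤ lam := ((le_max_left _ _).trans (le_max_right _ _)).trans hlamΛ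
  have h3 : max N 0 - Real.log A ≤ lam := ((le_max_right _ _).trans (le_max_right _ _)).trans hlamΛ
  have hlam0 : 0 < lam := by linarith
  -- `K = ⌈l/α⌉` makes `exp(Kα)` about `A lam / ε`. Since `l ≤ 3 lam`, also `K ≤ 4 lam / α`, and `A
  -- = 4M/α` is exactly what turns `M K exp(-Kα)` into at most `ε`.
  set l := Real.log (A * lam / ε) with hl
  have hle : l = Real.log A + Real.log lam + lam := by
    rw [hl, div_eq_mul_one_div, Real.log_mul (by positivity) (by positivity),
      Real.log_mul hApos.ne' hlam0.ne']
  have hloglam0 : 0 ≤ Real.log lam := Real.log_nonneg h1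
  have hloglam : Real.log lam ≤ lam := (Real.log_le_sub_one_of_pos hlam0).trans (by linarith)
  have hexpl : Real.exp l = A * lam / ε := Real.exp_log (by positivity)
  have hKge := Nat.le_ceil (l / α)
  have hKl : l ≤ ⌈l / α⌉₊ * α := by rwa [div_le_iff₀ hα] at hKge
  have hNK : N ≤ ⌈l / α⌉₊ := by
    have hK0 : (0 : ℝ) ≤ ⌈l / α⌉₊ := Nat.cast_nonneg _
    have := mul_le_of_le_one_right hK0 hα1
    linarith [le_max_left N 0]
  have hl0 : 0 ≤ l := by linarith [le_max_right N 0]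
  have hKle : (⌈l / α⌉₊ : ℝ) ≤ l / α + 1 := (Nat.ceil_lt_add_one (by positivity)).le
  have hone : 1 ≤ lam / α := by rw [le_div_iff₀ hα]; linarith
  have hK4 : (⌈l / α⌉₊ : ℝ) ≤ 4 * lam / α := by
    have : l / α ≤ 3 * lam / α := by gcongr; linarith
    have e : 4 * lam / α = 3 * lam / α + lam / α := by ring
    linarith
  refine ⟨⌈l / α⌉₊, hNK, h1, hK4, ?_, ?_⟩
  · have h4 : Real.exp (-(⌈l / α⌉₊ * α)) ≤ ε / (A * lam) := by
      rw [Real.exp_neg, inv_le_comm₀ (Real.exp_pos _) (by positivity), inv_div, ← hexpl]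
      exact Real.exp_le_exp.2 hKl
    calc M * ⌈l / α⌉₊ * Real.exp (-(⌈l / α⌉₊ * α)) ≤ M * (4 * lam / α) * (ε / (A * lam)) := by
          gcongr
      _ = ε := by rw [hA]; field_simp
  · have e : 12 * M * lam / (α * ε) = 3 * (A * lam / ε) := by rw [hA]; field_simp; ring
    rw [e, ← hexpl]
    have h5 : ⌈l / α⌉₊ * α ≤ l + α := by
      have := mul_le_mul_of_nonneg_right hKle hα.le
      rwa [add_mul, div_mul_cancel₀ _ hα.ne', one_mul] at this
    calc Real.exp (⌈l / α⌉₊ * α) ≤ Real.exp α * Real.exp l := by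
          rw [← Real.exp_add]; exact Real.exp_le_exp.2 (by linarith)
      _ ≤ _ := by gcongr; exact exp_one_le_three hα1

end Schedule

/-- The number of epochs, the iteration count and the resulting bound of the expected gap. -/
lemma exists_epochs_of_params {ℓ L ρ μ μx μy B η₀ : ℝ} (hL : 0 ≤ L) (hρ : 0 < ρ) (hρℓ : ρ ≤ ℓ)
    (hμ : 0 < μ) (hμL : μ ≤ L + 2 * ρ) (hμx : 0 < μx) (hμy : 0 < μy) (hB : 0 < B) (hη₀ : 0 < η₀) :
    ∃ εbar : ℝ, 0 < εbar ∧ ∀ ε : ℝ, 0 < ε → ε < εbar → ∃ K : ℕ,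
      ((∑ k ∈ Finset.range K, epochLength L ρ μ μy η₀ k : ℕ) : ℝ)
        ≤ 81 * 25847041 * ((L + ρ) ^ 2 * (ρ / μx + 1) * B ^ 2 / (μ ^ 2 * min ρ μy * ε))
          * Real.log (1 / ε) ∧
      4 * (ρ / μx + 1) *
        ((1 - rate L ρ μ) ^ K * (27 * (B ^ 2 / (2 * μx) + B ^ 2 / (2 * μy)))
        + ∑ j ∈ Finset.range K, (1 - rate L ρ μ) ^ (K - 1 - j) *
          (47 * (9 * B ^ 2 * stepSize L ρ μ η₀ j
            + 5 * noiseCoeff ℓ ρ μy * B ^ 2 * stepSize L ρ μ η₀ j ^ 2))) ≤ ε := by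
  have hα := rate_pos hL hρ hμ
  have hα1 := rate_le_one hL hρ hμ
  have hinv := one_div_rate_le hL hρ hμ hμL
  have hm : 0 < min ρ μy := lt_min hρ hμy
  have hsumT := sum_epochLength_le (L := L) (ρ := ρ) (μ := μ) hη₀ hm hα
  have hKn : 0 ≤ noiseCoeff ℓ ρ μy := by
    have := hρ.le.trans hρℓ
    rw [noiseCoeff]; positivity
  set α := rate L ρ μ with hαdef
  set kn := noiseCoeff ℓ ρ μy
  set m := min ρ μy
  set κ := ρ / μx + 1 with hκ
  have hκ0 : 0 < κ := by positivity
  have hr : Real.exp (-α) < 1 := by rw [Real.exp_lt_one_iff]; linarith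
  have hS : 0 ≤ 1 / (1 - Real.exp (-α)) := by
    have : 0 < 1 - Real.exp (-α) := by linarith
    positivity
  set Φ := 27 * (B ^ 2 / (2 * μx) + B ^ 2 / (2 * μy)) with hΦ
  have hΦ0 : 0 ≤ Φ := by positivity
  set Φ' := Φ + 705 * kn * B ^ 2 * η₀ ^ 2 * (1 / (1 - Real.exp (-α))) with hΦ'
  -- `5080 = 4 · 1270`, and `1270 = 1269 + 1`: once `K ≥ Φ'/(B²η₀)`, the initial potential and the
  -- second-order noise together cost one more unit of `K B²η₀`.
  set M := 5080 * κ * B ^ 2 * η₀ with hM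
  have hM0 : 0 < M := by positivity
  obtain ⟨ε₁, hε₁, hε⟩ := exists_epochs hα hα1 hM0 (Φ' / (B ^ 2 * η₀))
  -- The second threshold makes the `K` extra iterations from rounding up the epoch lengths
  -- negligible against the main term.
  refine ⟨min ε₁ (κ * B ^ 2 / (4 * m * α)), by positivity, fun ε h0 hlt => ?_⟩
  obtain ⟨K, hNK, hlam, hK4, hKe, hKexp⟩ := hε ε h0 (hlt.trans_le (min_le_left _ _))
  have hlt2 := hlt.trans_le (min_le_right _ _)
  set lam := Real.log (1 / ε)
  refine ⟨K, ?_, ?_⟩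
  · set X := κ * B ^ 2 * lam / (m * ε) with hX
    have hX0 : 0 ≤ X := by positivity
    -- `25847040 = 424 · 12 · 5080`. The `η₀` in `M` cancels the one in the epoch lengths; the
    -- rounding adds one unit, and the bound `1/α ≤ 9(L + ρ)/μ` squared gives the factor 81.
    have t1 : 424 / (η₀ * m) * (Real.exp (K * α) / α) ≤ 25847040 * ((1 / α) ^ 2 * X) := by
      calc _ ≤ 424 / (η₀ * m) * (12 * M * lam / (α * ε) / α) := by gcongr
        _ = _ := by rw [hM, hX]; field_simp; norm_num
    have t2 : (K : ℝ) ≤ (1 / α) ^ 2 * X := by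
      refine hK4.trans ?_
      rw [lt_div_iff₀ (by positivity)] at hlt2
      have e : (1 / α) ^ 2 * X = lam / α * (κ * B ^ 2 / (m * α * ε)) := by
        rw [hX]; field_simp
      have e' : 4 * lam / α = lam / α * 4 := by ring
      rw [e, e']
      have : 4 ≤ κ * B ^ 2 / (m * α * ε) := by
        rw [le_div_iff₀ (by positivity)]; linarith
      gcongr
    have t3 : (1 / α) ^ 2 ≤ (9 * ((L + ρ) / μ)) ^ 2 := by gcongr
    calc _ ≤ 25847041 * ((1 / α) ^ 2 * X) := (hsumT K).trans (by linarith)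
      _ ≤ 25847041 * ((9 * ((L + ρ) / μ)) ^ 2 * X) := by gcongr
      _ = _ := by rw [hX]; field_simp; norm_num
  · have h1 := noise_sum_le hα hα1 hη₀ (sq_nonneg B) hKn K
    have h2 : (1 - α) ^ K ≤ Real.exp (-(K * α)) := by
      calc (1 - α) ^ K ≤ Real.exp (-α) ^ K := by
            refine pow_le_pow_left₀ (by linarith) ?_ _
            linarith [Real.add_one_le_exp (-α)]
        _ = _ := by rw [← Real.exp_nat_mul]; congr 1; ring
    have h3 := mul_le_mul_of_nonneg_right h2 hΦ0
    have h4 : Φ' ≤ K * (B ^ 2 * η₀) := by rwa [div_le_iff₀ (by positivity)] at hNK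
    have h5 : Φ + (1269 * (B ^ 2 * η₀) * K
        + 705 * kn * B ^ 2 * η₀ ^ 2 * (1 / (1 - Real.exp (-α)))) ≤ 1270 * (K * (B ^ 2 * η₀)) := by
      linarith
    have h6 := mul_le_mul_of_nonneg_left h5 (Real.exp_pos (-(K * α))).le
    simp only [stepSize, ← hαdef]
    calc _ ≤ 4 * κ * (Real.exp (-(K * α)) * (1270 * (K * (B ^ 2 * η₀)))) := by
          refine mul_le_mul_of_nonneg_left ?_ (by positivity)
          linarith
      _ = M * K * Real.exp (-(K * α)) := by rw [hM]; ring
      _ ≤ ε := hKe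

end MinMaxPL

/-- Duality-gap iteration complexity of the proximal epoch method with SGDA updates:
`C` is an absolute constant, and the threshold `εbar` below which the bound holds as well as the
number of epochs `K` depend only on the numerical parameters (and `K` on `ε`). -/
theorem mainTheorem7 :
    ∃ C : ℝ, 0 < C ∧
    ∀ ℓ L ρ μ μx μy B η₀ : ℝ,
      0 ≤ L → 0 < ρ → ρ ≤ ℓ → 0 < μ → μ ≤ L + 2 * ρ → 0 < μx → 0 < μy → 0 < B →
      0 < η₀ → η₀ ≤ 1 / ρ →
    ∃ εbar : ℝ, 0 < εbar ∧ ∀ ε : ℝ, 0 < ε → ε < εbar →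
    ∃ K : ℕ,
      -- total number of inner iterations
      ((∑ k ∈ Finset.range K, MinMaxPL.epochLength L ρ μ μy η₀ k : ℕ) : ℝ)
        ≤ C * ((L + ρ) ^ 2 * (ρ / μx + 1) * B ^ 2 / (μ ^ 2 * min ρ μy * ε)) * Real.log (1 / ε) ∧
      ∀ (d d' : ℕ) (Y : Set (EuclideanSpace ℝ (Fin d')))
        (f : EuclideanSpace ℝ (Fin d) → EuclideanSpace ℝ (Fin d') → ℝ)
        (x₀ : EuclideanSpace ℝ (Fin d)) (y₀ : EuclideanSpace ℝ (Fin d'))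
        -- the stochastic gradient oracle
        (Ξ : Type*) (_ : MeasurableSpace Ξ) (D : Measure Ξ) (_ : IsProbabilityMeasure D)
        (Gx : EuclideanSpace ℝ (Fin d) → EuclideanSpace ℝ (Fin d') → Ξ → EuclideanSpace ℝ (Fin d))
        (Gy : EuclideanSpace ℝ (Fin d) → EuclideanSpace ℝ (Fin d') → Ξ → EuclideanSpace ℝ (Fin d'))
        -- the samples
        (Ω : Type*) (_ : MeasurableSpace Ω) (P : Measure Ω) (_ : IsProbabilityMeasure P)
        (ξ : ℕ → ℕ → Ω → Ξ),
        IsClosed Y → Convex ℝ Y → y₀ ∈ Y →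
        -- structure of the objective
        MinMaxPL.HasLipschitzGradOn ℓ f Y →
        (∀ x, StrongConcaveOn Y μy (f x)) →
        MinMaxPL.IsSmoothFun L (MinMaxPL.primal f Y) →
        MinMaxPL.SatisfiesPL μ (MinMaxPL.primal f Y) →
        (∀ y ∈ Y, MinMaxPL.SatisfiesPL μx (fun x => f x y)) →
        (∀ y ∈ Y, MinMaxPL.IsWeaklyConvex ρ (fun x => f x y)) →
        -- the oracle is measurable and unbiased
        Measurable (fun p : (EuclideanSpace ℝ (Fin d) × EuclideanSpace ℝ (Fin d')) × Ξ =>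
          Gx p.1.1 p.1.2 p.2) →
        Measurable (fun p : (EuclideanSpace ℝ (Fin d) × EuclideanSpace ℝ (Fin d')) × Ξ =>
          Gy p.1.1 p.1.2 p.2) →
        (∀ x, ∀ y ∈ Y, Integrable (Gx x y) D ∧ ∫ s, Gx x y s ∂D = MinMaxPL.gradX f x y) →
        (∀ x, ∀ y ∈ Y, Integrable (Gy x y) D ∧ ∫ s, Gy x y s ∂D = MinMaxPL.gradY f x y) →
        -- the samples are independent with law `D`
        (∀ k t, Measurable (ξ k t)) → (∀ k t, Measure.map (ξ k t) P = D) →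
        iIndepFun (fun p : ℕ × ℕ => ξ p.1 p.2) P →
        -- the stochastic gradients used by the method have second moments at most `B ^ 2`
        MinMaxPL.BoundedGradAlongRun P L ρ μ μy η₀ B Y Gx Gy (x₀, y₀) ξ →
        -- the expected duality gap after `K` epochs is at most `ε`
        let zK : Ω → EuclideanSpace ℝ (Fin d) × EuclideanSpace ℝ (Fin d') := fun ω =>
          MinMaxPL.output L ρ μ μy η₀ Y Gx Gy (x₀, y₀) (fun i j => ξ i j ω) K
        Integrable (fun ω => MinMaxPL.dualityGap f Y (zK ω).1 (zK ω).2) P ∧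
          ∫ ω, MinMaxPL.dualityGap f Y (zK ω).1 (zK ω).2 ∂P ≤ ε := by
  refine ⟨81 * 25847041, by norm_num, ?_⟩
  intro ℓ L ρ μ μx μy B η₀ hL hρ hρℓ hμ hμL hμx hμy hB hη₀ hη₀ρ
  obtain ⟨εbar, hεbar, h⟩ := MinMaxPL.exists_epochs_of_params (ℓ := ℓ) hL hρ hρℓ hμ hμL hμx hμy hB
    hη₀
  refine ⟨εbar, hεbar, fun ε h0 hlt => ?_⟩
  obtain ⟨K, hK1, hK2⟩ := h ε h0 hlt
  refine ⟨K, hK1, ?_⟩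
  intro d d' Y f x₀ y₀ Ξ _ D _ Gx Gy Ω _ P _ ξ hc hY hy₀ hgrad hconc hsm hpl hplx hweak hmx hmy
    hux huy hξ hlaw hind hbd zK
  have hreg : MinMaxPL.RegularObjective ℓ L ρ μ μx μy f Y :=
    ⟨hL, hρ, hρℓ, hμ, hμL, hμx, hμy, hc, hY, hgrad, hconc, hsm, hpl, hplx, hweak⟩
  have ho : MinMaxPL.IsOracle P D f Y Gx Gy ξ := ⟨hmx, hmy, hux, huy, hξ, hlaw, hind⟩
  have hα := MinMaxPL.rate_pos hL hρ hμ
  have hηρ : ∀ k, ρ * MinMaxPL.stepSize L ρ μ η₀ k ≤ 1 := fun k => by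
    have h1 := mul_le_mul_of_nonneg_left
      ((MinMaxPL.stepSize_le hη₀ hα k).trans hη₀ρ) hρ.le
    rwa [mul_one_div_cancel hρ.ne'] at h1
  obtain ⟨h1, h2⟩ := hreg.integral_dualityGap_le (B := B) (z₀ := (x₀, y₀)) ho
    (MinMaxPL.stepSize_pos hη₀) hηρ
    (MinMaxPL.le_stepSize_mul_epochLength hη₀ (lt_min hρ hμy)) hy₀ hbd K
  exact ⟨h1, h2.trans hK2⟩
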